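/- For a finite tree $T$ let $N(T)$ be the number of its subtrees, i.e. of nonempty subgraphs of $T$ that are trees. For a locally finite tree $T$ and a vertex $v$ let $N(T-e,v)\in\{1,2,\dots\}\cup\{\infty\}$ be the number of trees that contain $v$ and are subgraphs of the graph $T-e$ obtained from $T$ by deleting the edge $e$, and let $M(T,v)=\min_{e\ni v}N(T-e,v)$, the minimum being over the edges $e$ incident with $v$ (and $M(T,v)=\infty$ if there is none). Put $f(T,v)=\log\bigl(1+\tfrac1{M(T,v)}\bigr)$, with $1/\infty=0$. Let $\mathcal{RT}$ be the set of locally finite rooted trees up to rooted isomorphism, with the $\sigma$-algebra generated by the isomorphism types of the closed balls of all radii around the root. A sequence of finite graphs $G_n$ is Benjamini–Schramm convergent with limit statistics $s$ if for every radius $r$ and every rooted graph $H$ the probability that the closed $r$-ball centred at a uniformly random vertex of $G_n$ is isomorphic to $H$ as a rooted graph converges to $s(H,r)$, and $s(\cdot,r)$ is a probability distribution (on isomorphism classes of rooted graphs) for every $r$. **Theorem.** Let $T_n$ be finite trees with $|T_n|\to\infty$ that are Benjamini–Schramm convergent with limit statistics $s$. Then there is exactly one probability measure $\sigma$ on $\mathcal{RT}$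 such that, for every $r$ and $H$, the closed $r$-ball around the root of a $\sigma$-random rooted tree is isomorphic to $H$ with probability $s(H,r)$. The function $f$ is $\sigma$-integrable, and $$\lim_{n\to\infty}\frac{\log N(T_n)}{|T_n|}=\mathbb{E}_\sigma[f]=\int_{\mathcal{RT}}\log\Bigl(1+\frac1{M(T,v)}\Bigr)\,d\sigma(T,v).$$ In particular, the limit exists and depends only on the Benjamini–Schramm limit of the sequence. -/

import Mathlib

open Filter Topology MeasureTheory

universe u

/-- A graph with a distinguished vertex (the root). -/
structure RootedGraph : Type (u + 1) where
  V : Type u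
  graph : SimpleGraph V
  root : V

/-- Two rooted graphs are isomorphic if some graph isomorphism maps root to root. -/
instance RootedGraph.isoSetoid : Setoid RootedGraph.{u} where
  r G H := ∃ φ : G.graph ≃g H.graph, φ G.root = H.root
  iseqv :=
    { refl := fun G => ⟨SimpleGraph.Iso.refl, rfl⟩
      symm := by
        rintro G H ⟨φ, h⟩
        refine ⟨φ.symm, ?_⟩
        rw [← h]
        exact φ.symm_apply_apply _
      trans := by
        rintro G H K ⟨φ, h⟩ ⟨ψ, k⟩
        exact ⟨ψ.comp φ, by simp [h, k]⟩ }

/-- Isomorphism classes of rooted graphs. -/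
def RGClass : Type (u + 1) := Quotient RootedGraph.isoSetoid.{u}

/-- The isomorphism class of the graph `G` rooted at `v`. -/
def rootedAt {V : Type u} (G : SimpleGraph V) (v : V) : RGClass.{u} :=
  Quotient.mk RootedGraph.isoSetoid ⟨V, G, v⟩

/-- The vertices at distance at most `r` from `v`. -/
def ballVerts {V : Type u} (G : SimpleGraph V) (v : V) (r : ℕ) : Set V :=
  {w | ∃ p : G.Walk v w, p.length ≤ r}

theorem ballVerts_map {V W : Type u} {G : SimpleGraph V} {H : SimpleGraph W} (φ : G ≃g H)
    {v w : V} {r : ℕ} (h : w ∈ ballVerts G v r) : φ w ∈ ballVerts H (φ v) r := by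
  obtain ⟨p, hp⟩ := h
  exact ⟨p.map φ.toHom, by simpa using hp⟩

/-- The closed `r`-ball centred at the root: the subgraph induced by the vertices at distance at
most `r` from the root, with the same root. -/
def RootedGraph.ball (r : ℕ) (G : RootedGraph.{u}) : RootedGraph.{u} where
  V := ballVerts G.graph G.root r
  graph := G.graph.induce (ballVerts G.graph G.root r)
  root := ⟨G.root, SimpleGraph.Walk.nil, Nat.zero_le r⟩

theorem RootedGraph.ball_equiv (r : ℕ) {G H : RootedGraph.{u}}
    (h : ∃ φ : G.graph ≃g H.graph, φ G.root = H.root) :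
    ∃ φ : (G.ball r).graph ≃g (H.ball r).graph, φ (G.ball r).root = (H.ball r).root := by
  obtain ⟨φ, h⟩ := h
  refine ⟨φ.induce (s := ballVerts G.graph G.root r) (t := ballVerts H.graph H.root r)
    ⟨fun w hw => h ▸ ballVerts_map φ hw, φ.injective.injOn, fun w hw => ?_⟩, ?_⟩
  · have := ballVerts_map φ.symm hw
    rw [← h] at this
    refine ⟨φ.symm w, ?_, φ.apply_symm_apply w⟩
    simpa using this
  · exact Subtype.ext h

/-- The closed `r`-ball centred at the root, on isomorphism classes. -/
def RGClass.ball (r : ℕ) : RGClass.{u} → RGClass.{u} :=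
  Quotient.map (RootedGraph.ball r) fun _ _ h => RootedGraph.ball_equiv r h

/-- The set of locally finite rooted trees, up to rooted isomorphism. -/
def LFRootedTree : Type (u + 1) :=
  {x : RGClass.{u} // ∃ (V : Type u) (G : SimpleGraph V) (v : V),
    G.IsTree ∧ (∀ w, (G.neighborSet w).Finite) ∧ x = rootedAt G v}

/-- The `σ`-algebra on rooted trees generated by the `r`-balls around the root for all `r`, that is
the Borel `σ`-algebra of the rooted distance (there are only countably many finite rooted graphs
up to isomorphism). -/
instance : MeasurableSpace LFRootedTree.{u} :=
  ⨆ r : ℕ, MeasurableSpace.comap (fun x : LFRootedTree.{u} => x.1.ball r) ⊤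

/-- `σ(H, r)` for the finite graph `G`: the probability that the `r`-ball centred at a uniformly
random vertex of `G` is isomorphic to `H`. -/
noncomputable def ballFreq {V : Type u} (G : SimpleGraph V) (r : ℕ) (H : RGClass.{u}) : ℝ :=
  ({v : V | (rootedAt G v).ball r = H}.ncard : ℝ) / (Nat.card V : ℝ)

/-- The sequence `G n` of finite graphs is Benjamini–Schramm convergent with limit statistics `s`:
for all `r` and `H` the ball frequencies converge to `s r H`, and `s r` is a probability
distribution for every `r`. (Ball frequencies vanish at infinite `H`, and hence so does `s r`.) -/
def BSConvergesTo {V : ℕ → Type u} (G : ∀ n, SimpleGraph (V n)) (s : ℕ → RGClass.{u} → ℝ) : Prop :=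
  (∀ r H, Tendsto (fun n => ballFreq (G n) r H) atTop (𝓝 (s r H))) ∧ ∀ r, HasSum (s r) 1

/-- The `r`-ball around the root of a `σ`-random rooted tree is distributed according to `s r`,
for every `r`. -/
def HasBallStatistics (σ : ProbabilityMeasure LFRootedTree.{u}) (s : ℕ → RGClass.{u} → ℝ) : Prop :=
  ∀ r H, (σ : Measure LFRootedTree.{u}).real {x | x.1.ball r = H} = s r H

/-- `N(T)`: the number of subtrees of `T`, i.e. of (nonempty) subgraphs that are trees. -/
noncomputable def numSubtrees {V : Type u} (T : SimpleGraph V) : ℕ :=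
  {S : T.Subgraph | S.coe.IsTree}.ncard

/-- `N(T, v)`: the number (possibly infinite) of subtrees of `T` that contain `v`. -/
noncomputable def numSubtreesAt {V : Type u} (T : SimpleGraph V) (v : V) : ℕ∞ :=
  {S : T.Subgraph | S.coe.IsTree ∧ v ∈ S.verts}.encard

/-- `M(T, v)`: the minimum of `N(T - e, v)` over all edges `e` incident with `v`. (If there is no
such edge, the value is `∞`.) -/
noncomputable def minSubtreesAt {V : Type u} (T : SimpleGraph V) (v : V) : ℕ∞ :=
  ⨅ e ∈ T.incidenceSet v, numSubtreesAt (T.deleteEdges {e}) v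

theorem numSubtreesAt_le {V W : Type u} {G : SimpleGraph V} {H : SimpleGraph W} (φ : G ≃g H)
    (v : V) : numSubtreesAt G v ≤ numSubtreesAt H (φ v) := by
  refine Set.encard_le_encard_of_injOn (f := fun S => S.map φ.toHom) ?_ ?_
  · rintro S ⟨hS, hv⟩
    refine ⟨?_, ⟨v, hv, rfl⟩⟩
    let ψ : S.coe ≃g (S.map φ.toHom).coe :=
      { toEquiv := Equiv.Set.image φ S.verts φ.injective
        map_rel_iff' := by
          rintro ⟨a, ha⟩ ⟨b, hb⟩
          constructor
          · rintro ⟨a', b', h, h1, h2⟩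
            have e1 : a' = a := φ.injective h1
            have e2 : b' = b := φ.injective h2
            subst e1 e2
            exact h
          · intro h
            exact ⟨a, b, h, rfl, rfl⟩ }
    exact ψ.isTree_iff.mp hS
  · intro S _ S' _ h
    have h' : S.map φ.toHom = S'.map φ.toHom := h
    refine SimpleGraph.Subgraph.ext ?_ ?_
    · exact φ.injective.image_injective (congrArg SimpleGraph.Subgraph.verts h')
    · have key : ∀ (A B : G.Subgraph), A.map φ.toHom = B.map φ.toHom →
          ∀ a b, A.Adj a b → B.Adj a b := by
        intro A B hAB a b hab
        have : (A.map φ.toHom).Adj (φ a) (φ b) := ⟨a, b, hab, rfl, rfl⟩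
        rw [hAB] at this
        obtain ⟨a', b', h, h1, h2⟩ := this
        have e1 : a' = a := φ.injective h1
        have e2 : b' = b := φ.injective h2
        subst e1 e2
        exact h
      funext a b
      exact propext ⟨key S S' h' a b, key S' S h'.symm a b⟩

theorem minSubtreesAt_le {V W : Type u} {G : SimpleGraph V} {H : SimpleGraph W} (φ : G ≃g H)
    (v : V) : minSubtreesAt G v ≤ minSubtreesAt H (φ v) := by
  refine le_iInf₂ fun e he => ?_
  obtain ⟨e, rfl⟩ : ∃ e', Sym2.map φ e' = e :=
    ⟨Sym2.map φ.symm e, by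
      induction e using Sym2.ind with
      | _ a b => simp⟩
  induction e using Sym2.ind with
  | _ a b =>
    have hab : s(a, b) ∈ G.incidenceSet v := by
      obtain ⟨h1, h2⟩ := he
      refine ⟨?_, ?_⟩
      · simpa [φ.map_adj_iff] using h1
      · simpa [Sym2.mem_iff, φ.injective.eq_iff] using h2
    refine (iInf₂_le _ hab).trans ?_
    let ψ : G.deleteEdges {s(a, b)} ≃g H.deleteEdges {Sym2.map φ s(a, b)} :=
      { toEquiv := φ.toEquiv
        map_rel_iff' := by
          intro x y
          simp [SimpleGraph.deleteEdges_adj, φ.injective.eq_iff, φ.map_adj_iff] }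
    exact numSubtreesAt_le ψ v

theorem minSubtreesAt_eq {V W : Type u} {G : SimpleGraph V} {H : SimpleGraph W} (φ : G ≃g H)
    (v : V) : minSubtreesAt G v = minSubtreesAt H (φ v) := by
  refine le_antisymm (minSubtreesAt_le φ v) ?_
  simpa using minSubtreesAt_le φ.symm (φ v)

/-- `M(T, v)` for an isomorphism class of rooted graphs. -/
noncomputable def RGClass.minSubtrees : RGClass.{u} → ℕ∞ :=
  Quotient.lift (fun G : RootedGraph.{u} => minSubtreesAt G.graph G.root) (by
    rintro G H ⟨φ, h⟩
    simp only [minSubtreesAt_eq φ G.root, h])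

/-- `f(T, v) = log (1 + 1 / M(T, v))`, with `1 / ∞ = 0`. -/
noncomputable def entropyFun (x : LFRootedTree.{u}) : ℝ :=
  Real.log (1 + ((x.1.minSubtrees : ENNReal)⁻¹).toReal)

/-! In a forest a subtree through v is determined by its vertex set, so it suffices to count the
connected sets N(T,v) through v. Every edge vw is a bridge; with a(v,w) = N(T-vw,v) (`sideCount`)
this gives N(T,v) = a(v,w)(1 + a(w,v)), and cutting all edges at v gives N(T,v) = ∏ (1 + a(c,v))
over the neighbours c.

Root a finite tree at r, with parent function p. Then N(T,r) and, for v ≠ r, a(v,p v) are products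
of 1 + a(c,v) over the children c. Taking logarithms and summing over all vertices telescopes to log
N(T,r) = Σ log(1 + 1/a(v,p v)) over v ≠ r (`log_ncard_connSets_eq_sum`). If r maximises N(T,r), the
edge towards the parent is the one attaining the minimum M(T,v) (`minSubtreesAt_eq_sideCount`), so
the summands no longer mention r. Since N(T,r) ≤ N(T) ≤ |T| N(T,r), log N(T) equals the sum of f
over all vertices up to log |T| + 1.

The function f is nearly local: the r-ball determines M up to truncation at r + 1
(`min_encard_connSets_induce`, `min_minSubtrees_ball`), hence f within 1/(r+1), uniformly. As the
limit statistics are probability distributions, no mass escapes and averages of bounded functions of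
the ball converge (`tendsto_tsum_mul_of_hasSum_one`).

For the existence of σ, the limit laws of the balls are consistent in the radius, so a Markov chain
of growing balls has them as marginals (`exists_projectiveLimit_of_countable`). A coherent sequence
of balls glues to a locally finite tree (`exists_lfRootedTree`). Uniqueness holds because the ball
events form a generating π-system. -/

/-! ### Subtrees of a forest as connected vertex sets -/

/-- The sets of vertices that contain `v` and in which every vertex is joined to `v` by a walk
within the set. -/
def connSets {V : Type u} (G : SimpleGraph V) (v : V) : Set (Set V) :=
  {S | v ∈ S ∧ ∀ x ∈ S, ∃ p : G.Walk v x, ∀ y ∈ p.support, y ∈ S}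

theorem connSets_mono {V : Type u} {G H : SimpleGraph V} (h : G ≤ H) (v : V) :
    connSets G v ⊆ connSets H v := by
  rintro S ⟨hv, hS⟩
  refine ⟨hv, fun x hx => ?_⟩
  obtain ⟨p, hp⟩ := hS x hx
  exact ⟨p.mapLe h, by simpa using hp⟩

theorem singleton_mem_connSets {V : Type u} (G : SimpleGraph V) (v : V) : {v} ∈ connSets G v :=
  ⟨rfl, by rintro x rfl; exact ⟨.nil, by simp⟩⟩

theorem SimpleGraph.Walk.IsPath.eq_of_isAcyclic {V : Type u} {G : SimpleGraph V}
    (hG : G.IsAcyclic) {a b : V} {p q : G.Walk a b} (hp : p.IsPath) (hq : q.IsPath) : p = q :=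
  Subtype.mk.inj ((hG.subsingleton_path a b).elim ⟨p, hp⟩ ⟨q, hq⟩)

/-- The edge ab and a path inside S are two paths of the forest with the same ends, so they
coincide. Thus subtrees are induced subgraphs. -/
theorem SimpleGraph.Subgraph.adj_of_preconnected_of_isAcyclic {V : Type u} {G : SimpleGraph V}
    (hG : G.IsAcyclic) {S : G.Subgraph} (hS : S.coe.Preconnected) {a b : V} (ha : a ∈ S.verts)
    (hb : b ∈ S.verts) (hab : G.Adj a b) : S.Adj a b := by
  obtain ⟨q, hq⟩ := (hS ⟨a, ha⟩ ⟨b, hb⟩).exists_isPath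
  have h1 : (q.map S.hom).IsPath := hq.map S.hom_injective
  have h2 : hab.toWalk.IsPath := by simp [hab.ne]
  have h3 := congrArg SimpleGraph.Walk.length (SimpleGraph.Walk.IsPath.eq_of_isAcyclic hG h1 h2)
  have h4 : q.length = 1 := (SimpleGraph.Walk.length_map S.hom q).symm.trans h3
  exact SimpleGraph.Walk.adj_of_length_eq_one h4

theorem connSets_induce_connected {V : Type u} {G : SimpleGraph V} {v : V} {S : Set V}
    (hS : S ∈ connSets G v) : (G.induce S).Connected := by
  have : ∀ x : S, (G.induce S).Reachable ⟨v, hS.1⟩ x := by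
    rintro ⟨x, hx⟩
    obtain ⟨p, hp⟩ := hS.2 x hx
    exact ⟨p.induce S hp⟩
  exact { preconnected := fun x y => (this x).symm.trans (this y), nonempty := ⟨⟨v, hS.1⟩⟩ }

theorem numSubtreesAt_eq_encard_connSets {V : Type u} {G : SimpleGraph V} (hG : G.IsAcyclic)
    (v : V) : numSubtreesAt G v = (connSets G v).encard := by
  have hinj : Set.InjOn SimpleGraph.Subgraph.verts
      {S : G.Subgraph | S.coe.IsTree ∧ v ∈ S.verts} := by
    have key : ∀ S S' : G.Subgraph, S.verts = S'.verts → S'.coe.IsTree →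
        ∀ a b, S.Adj a b → S'.Adj a b := by
      intro S S' h hS' a b hab
      exact S'.adj_of_preconnected_of_isAcyclic hG hS'.connected.preconnected
        (h ▸ S.edge_vert hab) (h ▸ S.edge_vert hab.symm) hab.adj_sub
    rintro S hS S' hS' h
    refine SimpleGraph.Subgraph.ext h ?_
    ext a b
    exact ⟨key S S' h hS'.1 a b, key S' S h.symm hS.1 a b⟩
  rw [numSubtreesAt, ← hinj.encard_image]
  congr 1
  ext S
  constructor
  · rintro ⟨S, ⟨hS, hv⟩, rfl⟩
    refine ⟨hv, fun x hx => ?_⟩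
    obtain ⟨p⟩ := hS.connected.preconnected ⟨v, hv⟩ ⟨x, hx⟩
    refine ⟨p.map S.hom, fun y hy => ?_⟩
    obtain ⟨z, -, rfl⟩ := List.mem_map.1 (SimpleGraph.Walk.support_map S.hom p ▸ hy)
    exact z.2
  · intro hS
    refine ⟨(⊤ : G.Subgraph).induce S, ⟨⟨?_, hG.subgraph _⟩, hS.1⟩, rfl⟩
    exact ((SimpleGraph.connected_induce_iff).1 (connSets_induce_connected hS)).coe

theorem encard_connSets_le_of_induce {V : Type u} (G : SimpleGraph V) {B : Set V} {v : V}
    (hv : v ∈ B) : (connSets (G.induce B) ⟨v, hv⟩).encard ≤ (connSets G v).encard := by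
  refine Set.encard_le_encard_of_injOn (f := fun S => Subtype.val '' S) ?_
    (Subtype.val_injective.image_injective.injOn)
  rintro S ⟨h1, h2⟩
  refine ⟨⟨_, h1, rfl⟩, ?_⟩
  rintro _ ⟨x, hx, rfl⟩
  obtain ⟨p, hp⟩ := h2 x hx
  refine ⟨p.map (SimpleGraph.Embedding.induce B).toHom, fun y hy => ?_⟩
  obtain ⟨z, hz, rfl⟩ := List.mem_map.1
    (SimpleGraph.Walk.support_map (SimpleGraph.Embedding.induce B).toHom p ▸ hy)
  exact ⟨z, hp z hz, rfl⟩

theorem preimage_mem_connSets_induce {V : Type u} {G : SimpleGraph V} {B S : Set V} {v : V}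
    (hv : v ∈ B) (hS : S ∈ connSets G v) (hSB : S ⊆ B) :
    (Subtype.val ⁻¹' S : Set B) ∈ connSets (G.induce B) ⟨v, hv⟩ := by
  refine ⟨hS.1, ?_⟩
  rintro ⟨x, hxB⟩ hx
  obtain ⟨p, hp⟩ := hS.2 x hx
  refine ⟨p.induce B fun y hy => hSB (hp y hy), ?_⟩
  rintro ⟨y, hy⟩ h
  refine hp y ?_
  simpa using h

/-! ### Locality of the counts -/

/-- Counts of connected sets agree on a ball of radius `r`, up to truncation at `r + 1`. -/
theorem min_encard_connSets_induce {V : Type u} {G : SimpleGraph V} {B : Set V} {v : V}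
    (hv : v ∈ B) {r : ℕ} (hB : ballVerts G v r ⊆ B) :
    min (connSets (G.induce B) ⟨v, hv⟩).encard (r + 1) = min (connSets G v).encard (r + 1) := by
  by_cases h : ∀ S ∈ connSets G v, S ⊆ B
  · congr 1
    refine le_antisymm (encard_connSets_le_of_induce G hv) ?_
    refine Set.encard_le_encard_of_injOn (f := fun S => Subtype.val ⁻¹' S)
      (fun S hS => preimage_mem_connSets_induce hv hS (h S hS)) ?_
    intro S hS S' hS' hSS
    have := congrArg (fun A => Subtype.val '' A) hSS
    simpa [Subtype.image_preimage_coe, Set.inter_eq_right.2 (h S hS),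
      Set.inter_eq_right.2 (h S' hS')] using this
  -- A connected set leaving B yields a path from v of length greater than r. Its initial segments
  -- with 0, …, r steps are r + 1 distinct connected sets inside B, so both truncated counts equal r
  -- + 1.
  · push Not at h
    obtain ⟨S, hS, hSB⟩ := h
    obtain ⟨x, hx, hxB⟩ := Set.not_subset.1 hSB
    classical
    obtain ⟨q, -⟩ := hS.2 x hx
    obtain ⟨p, hp⟩ : ∃ p : G.Walk v x, p.IsPath := ⟨q.toPath, q.toPath.2⟩
    have hlen : r < p.length := by
      by_contra! hle
      exact hxB (hB ⟨p, hle⟩)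
    suffices hr : (r + 1 : ℕ∞) ≤ (connSets (G.induce B) ⟨v, hv⟩).encard by
      rw [min_eq_right hr, min_eq_right (hr.trans (encard_connSets_le_of_induce G hv))]
    let A : ℕ → Set V := fun k => p.getVert '' Set.Iic k
    have hA : ∀ k, A k ∈ connSets G v := by
      intro k
      refine ⟨⟨0, by simp, by simp⟩, ?_⟩
      rintro _ ⟨i, hi, rfl⟩
      refine ⟨p.take i, fun y hy => ?_⟩
      obtain ⟨j, rfl, hj⟩ := SimpleGraph.Walk.mem_support_iff_exists_getVert.1 hy
      refine ⟨min i j, Set.mem_Iic.2 ((min_le_left _ _).trans hi), ?_⟩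
      simp [SimpleGraph.Walk.take_getVert]
    have hAB : ∀ k ≤ r, A k ⊆ B := by
      rintro k hk _ ⟨i, hi, rfl⟩
      exact hB ⟨p.take i, by
        rw [SimpleGraph.Walk.take_length]
        exact (min_le_left _ _).trans (le_trans hi hk)⟩
    have hinj : Set.InjOn (fun k => (Subtype.val ⁻¹' A k : Set B)) (Finset.range (r + 1)) := by
      have key : ∀ i j, i < j → j ≤ r → p.getVert j ∈ A i → False := by
        rintro i j hij hjr ⟨l, hl, hlj⟩
        have hl' : l ≤ i := hl
        have := hp.getVert_injOn (by simp; omega) (by simp; omega) hlj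
        omega
      intro i hi j hj hij
      have hi' : i ≤ r := by simpa [Nat.lt_succ_iff] using hi
      have hj' : j ≤ r := by simpa [Nat.lt_succ_iff] using hj
      have h1 : A i = A j := by
        have := congrArg (fun C => Subtype.val '' C) hij
        simpa [Subtype.image_preimage_coe, Set.inter_eq_right.2 (hAB i hi'),
          Set.inter_eq_right.2 (hAB j hj')] using this
      rcases lt_trichotomy i j with h | h | h
      · exact (key i j h hj' (h1 ▸ ⟨j, Set.mem_Iic.2 le_rfl, rfl⟩)).elim
      · exact h
      · exact (key j i h hi' (h1 ▸ ⟨i, Set.mem_Iic.2 le_rfl, rfl⟩)).elim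
    calc (r + 1 : ℕ∞) = ((Finset.range (r + 1) : Finset ℕ) : Set ℕ).encard := by
          rw [Set.encard_coe_eq_coe_finsetCard]; simp
      _ ≤ _ := Set.encard_le_encard_of_injOn (f := fun k => (Subtype.val ⁻¹' A k : Set B)) (by
          intro k hk
          have hk' : k ≤ r := by simpa [Nat.lt_succ_iff] using hk
          exact preimage_mem_connSets_induce hv (hA k) (hAB k hk')) hinj

/-! ### Splitting along edges -/

/-- A connected set through v either avoids w, giving the summand 1, or is a unique disjoint union
of a connected set on the side of v and one on the side of w, because vw is a bridge. -/
theorem encard_connSets_eq_mul {V : Type u} {G : SimpleGraph V} (hG : G.IsAcyclic) {v w : V}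
    (hvw : G.Adj v w) : (connSets G v).encard =
      (connSets (G.deleteEdges {s(v, w)}) v).encard *
        (1 + (connSets (G.deleteEdges {s(v, w)}) w).encard) := by
  classical
  set G' := G.deleteEdges {s(v, w)} with hG'
  have hle : G' ≤ G := G.deleteEdges_le _
  have hbr : ¬ G'.Reachable v w := by
    have := SimpleGraph.isAcyclic_iff_forall_adj_isBridge.1 hG hvw
    exact SimpleGraph.isBridge_iff.1 this
  have hreach : ∀ {x : V} {S : Set V}, S ∈ connSets G' x → ∀ y ∈ S, G'.Reachable x y :=
    fun hS y hy => ⟨(hS.2 y hy).choose⟩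
  have hdisj : ∀ {S S' : Set V}, S ∈ connSets G' v → S' ∈ connSets G' w → Disjoint S S' := by
    intro S S' hS hS'
    rw [Set.disjoint_left]
    exact fun x hx hx' => hbr ((hreach hS x hx).trans (hreach hS' x hx').symm)
  have hedge : ∀ {x y : V} (p : G.Walk x y), v ∉ p.support ∨ w ∉ p.support →
      ∀ e ∈ p.edges, e ∈ G'.edgeSet := by
    intro x y p hp e he
    rw [hG', SimpleGraph.edgeSet_deleteEdges]
    refine ⟨p.edges_subset_edgeSet he, ?_⟩
    rintro rfl
    exact hp.elim (· (p.fst_mem_support_of_mem_edges he)) (· (p.snd_mem_support_of_mem_edges he))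
  -- Any vertex of a connected set lies on the side of `v` or on the side of `w`.
  have hside : ∀ {S : Set V}, S ∈ connSets G v → ∀ x ∈ S,
      (∃ p : G'.Walk v x, ∀ y ∈ p.support, y ∈ S) ∨
        (∃ p : G'.Walk w x, ∀ y ∈ p.support, y ∈ S) := by
    intro S hS x hx
    obtain ⟨q, hq⟩ := hS.2 x hx
    obtain ⟨p, hp, hpS⟩ : ∃ p : G.Walk v x, p.IsPath ∧ ∀ y ∈ p.support, y ∈ S :=
      ⟨q.bypass, q.bypass_isPath, fun y hy => hq y (q.support_bypass_subset_support hy)⟩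
    by_cases hw : w ∈ p.support
    -- In a forest, a path from v that meets the neighbour w goes there by its first edge; the rest
    -- of it avoids v.
    · have hsnd := hG.eq_snd_of_adj_start hp hvw hw
      cases p with
      | nil => simp at hw; exact (hvw.ne hw.symm).elim
      | @cons _ y _ h p =>
        simp at hsnd
        subst hsnd
        rw [SimpleGraph.Walk.cons_isPath_iff] at hp
        refine .inr ⟨p.transfer G' (hedge p (.inl hp.2)), fun y hy => hpS y ?_⟩
        rw [SimpleGraph.Walk.support_transfer] at hy
        simp [hy]
    · exact .inl ⟨p.transfer G' (hedge p (.inr hw)), fun y hy => hpS y (by simpa using hy)⟩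
  have hsplit : connSets G v = connSets G' v ∪
      (fun P : Set V × Set V => P.1 ∪ P.2) '' (connSets G' v ×ˢ connSets G' w) := by
    ext S
    constructor
    · intro hS
      by_cases hw : w ∈ S
      · right
        have hcomp : ∀ z ∈ S, {x | ∃ p : G'.Walk z x, ∀ y ∈ p.support, y ∈ S} ∈ connSets G' z := by
          intro z hz
          refine ⟨⟨.nil, by simpa using hz⟩, ?_⟩
          rintro x ⟨p, hp⟩
          refine ⟨p, fun y hy => ⟨p.takeUntil y hy, fun t ht => hp t ?_⟩⟩
          exact p.support_takeUntil_subset_support hy ht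
        refine ⟨⟨_, _⟩, ⟨hcomp v hS.1, hcomp w hw⟩, ?_⟩
        ext x
        refine ⟨?_, fun hx => hside hS x hx⟩
        rintro (⟨p, hp⟩ | ⟨p, hp⟩) <;> exact hp x p.end_mem_support
      · left
        refine ⟨hS.1, fun x hx => ?_⟩
        refine (hside hS x hx).resolve_right ?_
        rintro ⟨p, hp⟩
        exact hw (hp w p.start_mem_support)
    · rintro (hS | ⟨⟨S, S'⟩, ⟨hS, hS'⟩, rfl⟩)
      · exact connSets_mono hle v hS
      · refine ⟨.inl hS.1, ?_⟩
        rintro x (hx | hx)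
        · obtain ⟨p, hp⟩ := hS.2 x hx
          exact ⟨p.mapLe hle, fun y hy => .inl (hp y (by simpa using hy))⟩
        · obtain ⟨p, hp⟩ := hS'.2 x hx
          refine ⟨.cons hvw (p.mapLe hle), fun y hy => ?_⟩
          rw [SimpleGraph.Walk.support_cons, List.mem_cons] at hy
          rcases hy with rfl | hy
          · exact .inl hS.1
          · exact .inr (hp y (by simpa using hy))
  have hinj : Set.InjOn (fun P : Set V × Set V => P.1 ∪ P.2)
      (connSets G' v ×ˢ connSets G' w) := by
    rintro ⟨S, S'⟩ ⟨hS, hS'⟩ ⟨U, U'⟩ ⟨hU, hU'⟩ h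
    have h1 := Set.disjoint_left.1 (hdisj hS hU')
    have h2 := Set.disjoint_left.1 (hdisj hU hS')
    have h3 : ∀ x, x ∈ S ∪ S' ↔ x ∈ U ∪ U' := fun x => by
      have : S ∪ S' = U ∪ U' := h
      rw [this]
    have h4 := Set.disjoint_left.1 (hdisj hS hS')
    have h5 := Set.disjoint_left.1 (hdisj hU hU')
    simp only [Set.mem_union] at h3
    dsimp only at hS hS' hU hU'
    rw [Prod.mk.injEq]
    constructor <;> ext x <;> have := @h1 x <;> have := @h2 x <;> have := h3 x <;>
      have := @h4 x <;> have := @h5 x <;> tauto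
  rw [hsplit, Set.encard_union_eq, hinj.encard_image, Set.encard_prod, mul_add, mul_one]
  rw [Set.disjoint_left]
  rintro S hS ⟨⟨U, U'⟩, ⟨hU, hU'⟩, rfl⟩
  exact hbr (hreach hS w (.inr hU'.1))

/-- A connected set around c never meets v, so deleting edges at v does not affect it. -/
theorem connSets_deleteEdges_eq {V : Type u} {G H : SimpleGraph V} (hHG : H ≤ G) {v c : V}
    (hdel : ∀ a b, G.Adj a b → a ≠ v → b ≠ v → H.Adj a b) (hc : ¬ G.Reachable c v) :
    connSets H c = connSets G c := by
  refine (connSets_mono hHG c).antisymm ?_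
  rintro S ⟨hcS, hS⟩
  refine ⟨hcS, fun x hx => ?_⟩
  obtain ⟨p, hp⟩ := hS x hx
  have hv : v ∉ p.support := by
    classical
    exact fun h => hc ⟨p.takeUntil v h⟩
  refine ⟨p.transfer H ?_, by rwa [SimpleGraph.Walk.support_transfer]⟩
  intro e he
  induction e using Sym2.ind with
  | _ a b =>
    refine hdel a b (p.edges_subset_edgeSet he) ?_ ?_
    · rintro rfl
      exact hv (p.fst_mem_support_of_mem_edges he)
    · rintro rfl
      exact hv (p.snd_mem_support_of_mem_edges he)

theorem connSets_eq_singleton {V : Type u} {G : SimpleGraph V} {v : V} (h : ∀ w, ¬ G.Adj v w) :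
    connSets G v = {{v}} := by
  ext S
  refine ⟨?_, fun hS => by rw [Set.mem_singleton_iff.1 hS]; exact singleton_mem_connSets G v⟩
  rintro ⟨hv, hS⟩
  refine Set.mem_singleton_iff.2 (Set.eq_singleton_iff_unique_mem.2 ⟨hv, fun x hx => ?_⟩)
  obtain ⟨p, -⟩ := hS x hx
  cases p with
  | nil => rfl
  | cons h' _ => exact (h _ h').elim

/-! ### Product formulas and the maximising root in a finite tree -/

section Finite

variable {V : Type u} [Finite V] {G : SimpleGraph V}

theorem ncard_connSets_pos (G : SimpleGraph V) (v : V) : 0 < (connSets G v).ncard :=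
  (Set.ncard_pos (Set.toFinite _)).2 ⟨_, singleton_mem_connSets G v⟩

theorem ncard_connSets_eq_mul (hG : G.IsAcyclic) {v w : V} (hvw : G.Adj v w) :
    (connSets G v).ncard = (connSets (G.deleteEdges {s(v, w)}) v).ncard *
        (1 + (connSets (G.deleteEdges {s(v, w)}) w).ncard) := by
  have h := encard_connSets_eq_mul hG hvw
  simp only [← (Set.toFinite (connSets _ _)).cast_ncard_eq] at h
  exact_mod_cast h

theorem ncard_connSets_eq_mul_prod (hG : G.IsAcyclic) {v : V} (F : Finset V)
    (hF : ∀ c ∈ F, G.Adj v c) :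
    (connSets G v).ncard = (connSets (G.deleteEdges ((fun c => s(v, c)) '' F)) v).ncard *
      ∏ c ∈ F, (1 + (connSets (G.deleteEdges {s(v, c)}) c).ncard) := by
  classical
  induction F using Finset.induction_on with
  | empty => simp
  | insert d F hd ih =>
    rw [ih fun c hc => hF c (Finset.mem_insert_of_mem hc), Finset.prod_insert hd]
    set G₁ := G.deleteEdges ((fun c => s(v, c)) '' F) with hG₁
    have hvd : G.Adj v d := hF d (Finset.mem_insert_self d F)
    have h1 : G₁.Adj v d := by
      rw [hG₁, SimpleGraph.deleteEdges_adj]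
      refine ⟨hvd, ?_⟩
      rintro ⟨c, hc, h⟩
      have hcd : c = d := by
        rcases Sym2.eq_iff.1 h with h | h
        · exact h.2
        · exact h.2.trans h.1
      exact hd (hcd ▸ hc)
    have h2 : G.deleteEdges ((fun c => s(v, c)) '' (insert d F : Finset V)) =
        G₁.deleteEdges {s(v, d)} := by
      rw [hG₁, SimpleGraph.deleteEdges_deleteEdges, Finset.coe_insert, Set.image_insert_eq,
        Set.insert_eq, Set.union_comm]
    -- Once vd is cut, the side of d cannot see which other edges at v are missing.
    have h3 : connSets (G₁.deleteEdges {s(v, d)}) d = connSets (G.deleteEdges {s(v, d)}) d := by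
      refine connSets_deleteEdges_eq (v := v) ?_ ?_ ?_
      · rw [← h2]
        refine SimpleGraph.deleteEdges_anti ?_
        rintro _ rfl
        exact ⟨d, by simp, rfl⟩
      · intro a b hab ha hb
        rw [← h2, SimpleGraph.deleteEdges_adj]
        refine ⟨(SimpleGraph.deleteEdges_adj.1 hab).1, ?_⟩
        rintro ⟨c, -, h⟩
        rcases Sym2.eq_iff.1 h with h | h
        · exact ha h.1.symm
        · exact hb h.1.symm
      · intro h
        exact SimpleGraph.isBridge_iff.1
          (SimpleGraph.isAcyclic_iff_forall_adj_isBridge.1 hG hvd) h.symm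
    rw [ncard_connSets_eq_mul (hG.anti (G.deleteEdges_le _)) h1, h2, h3]
    ring

/-- The number of connected sets that contain `v` and do not use the edge `vw`. -/
noncomputable def sideCount (G : SimpleGraph V) (v w : V) : ℕ :=
  (connSets (G.deleteEdges {s(v, w)}) v).ncard

theorem sideCount_pos (G : SimpleGraph V) (v w : V) : 0 < sideCount G v w :=
  ncard_connSets_pos _ _

theorem ncard_connSets_eq_sideCount_mul (hG : G.IsAcyclic) {v w : V} (hvw : G.Adj v w) :
    (connSets G v).ncard = sideCount G v w * (1 + sideCount G w v) := by
  rw [ncard_connSets_eq_mul hG hvw, sideCount, sideCount, Sym2.eq_swap]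

theorem ncard_connSets_eq_prod (hG : G.IsAcyclic) (v : V) (F : Finset V)
    (hF : ∀ c, c ∈ F ↔ G.Adj v c) :
    (connSets G v).ncard = ∏ c ∈ F, (1 + sideCount G c v) := by
  rw [ncard_connSets_eq_mul_prod hG F fun c hc => (hF c).1 hc, connSets_eq_singleton,
    Set.ncard_singleton, one_mul]
  · refine Finset.prod_congr rfl fun c _ => ?_
    rw [sideCount, Sym2.eq_swap]
  · intro w hw
    rw [SimpleGraph.deleteEdges_adj] at hw
    exact hw.2 ⟨w, (hF w).2 hw.1, rfl⟩

/-- By the product formula, `sideCount G v d` is the product of the factors 1 + a(c,v) over the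
neighbours c ≠ d, and w contributes one of them. -/
theorem one_add_sideCount_le (hG : G.IsAcyclic) {v w d : V} (hw : G.Adj v w) (hd : G.Adj v d)
    (hwd : w ≠ d) : 1 + sideCount G w v ≤ sideCount G v d := by
  classical
  have := Fintype.ofFinite V
  have h1 := ncard_connSets_eq_prod hG v {c | G.Adj v c} (by simp)
  rw [ncard_connSets_eq_sideCount_mul hG hd] at h1
  have h2 : ({w, d} : Finset V) ⊆ ({c | G.Adj v c} : Finset V) := by
    intro c hc
    rcases Finset.mem_insert.1 hc with rfl | hc
    · simpa using hw
    · rw [Finset.mem_singleton.1 hc]; simpa using hd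
  have h3 := Finset.prod_le_prod_of_subset_of_one_le' (f := fun c => 1 + sideCount G c v) h2
    fun c _ _ => Nat.le_add_right 1 _
  rw [Finset.prod_pair hwd, ← h1] at h3
  exact Nat.le_of_mul_le_mul_right h3 (by omega)

/-- A tree with a root has a parent function. -/
theorem SimpleGraph.IsTree.exists_parent {V : Type u} {T : SimpleGraph V} (hT : T.IsTree) (r : V) :
    ∃ p : V → V, (∀ v, v ≠ r → T.Adj v (p v) ∧ T.dist r v = T.dist r (p v) + 1) ∧
      ∀ v w, T.Adj v w → (v ≠ r ∧ p v = w) ∨ (w ≠ r ∧ p w = v) := by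
  classical
  have hpath : ∀ v, ∃ q : T.Walk r v, q.IsPath ∧ q.length = T.dist r v := fun v =>
    (hT.connected r v).exists_path_of_dist
  choose q hq hlen using hpath
  have hmem : ∀ v w, T.Adj v w → w ∈ (q v).support → v ≠ r ∧ (q v).penultimate = w := by
    intro v w hvw hw
    refine ⟨?_, (hT.isAcyclic.eq_penultimate_of_adj_end (hq v) hvw hw).symm⟩
    rintro rfl
    have : q v = .nil := SimpleGraph.Walk.IsPath.eq_of_isAcyclic hT.isAcyclic (hq v) .nil
    rw [this] at hw
    simp at hw
    exact hvw.ne hw.symm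
  -- The parent is the last vertex before v on the path from r.
  refine ⟨fun v => (q v).penultimate, fun v hv => ?_, fun v w hvw => ?_⟩
  · have hnil : ¬ (q v).Nil := fun h => hv h.eq.symm
    have hadj := ((q v).adj_penultimate hnil).symm
    refine ⟨hadj, ?_⟩
    have h1 : (q v).dropLast.IsPath := (hq v).dropLast
    rw [← hlen v, ← hlen, SimpleGraph.Walk.IsPath.eq_of_isAcyclic hT.isAcyclic (hq _) h1]
    have := (q v).length_dropLast_add_one hnil
    omega
  · by_cases hw : w ∈ (q v).support
    · exact .inl (hmem v w hvw hw)
    · refine .inr (hmem w v hvw.symm ?_)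
      exact hT.isAcyclic.mem_support_of_ne_mem_support_of_adj_of_isPath (hq w) (hq v) hvw.symm hw

/-- Every non-root vertex is a child exactly once, so summing the logarithms of the product formulas
over all vertices gives Σ log(1 + a) = log N(T,r) + Σ log a, with a = a(v,p v) and v ≠ r. -/
theorem log_ncard_connSets_eq_sum {V : Type u} [Fintype V] [DecidableEq V] {T : SimpleGraph V}
    (hT : T.IsTree) {r : V} {p : V → V}
    (hp : ∀ v, v ≠ r → T.Adj v (p v) ∧ T.dist r v = T.dist r (p v) + 1)
    (hadj : ∀ v w, T.Adj v w → (v ≠ r ∧ p v = w) ∨ (w ≠ r ∧ p w = v)) :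
    Real.log (connSets T r).ncard =
      ∑ v ∈ Finset.univ.erase r, Real.log (1 + (sideCount T v (p v) : ℝ)⁻¹) := by
  let C : V → Finset V := fun v => (Finset.univ.erase r).filter fun c => p c = v
  have hpos : ∀ v w, (0 : ℝ) < sideCount T v w := fun v w => by exact_mod_cast sideCount_pos T v w
  have hroot : Real.log (connSets T r).ncard =
      ∑ c ∈ C r, Real.log (1 + sideCount T c (p c)) := by
    rw [ncard_connSets_eq_prod hT.isAcyclic r (C r)]
    · push_cast
      rw [Real.log_prod fun c _ => by have := hpos c r; positivity]
      exact Finset.sum_congr rfl fun c hc => by rw [(Finset.mem_filter.1 hc).2]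
    · intro c
      simp only [C, Finset.mem_filter, Finset.mem_erase, Finset.mem_univ, and_true]
      constructor
      · rintro ⟨h1, h2⟩
        have := (hp c h1).1
        rw [h2] at this
        exact this.symm
      · intro h
        exact (hadj r c h).resolve_left fun h => h.1 rfl
  have hnon : ∀ v ∈ Finset.univ.erase r, Real.log (sideCount T v (p v)) =
      ∑ c ∈ C v, Real.log (1 + sideCount T c (p c)) := by
    intro v hv
    have hv' : v ≠ r := Finset.ne_of_mem_erase hv
    have hpv : p v ∉ C v := by
      intro h
      obtain ⟨h1, h2⟩ := Finset.mem_filter.1 h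
      have h3 := (hp (p v) (Finset.ne_of_mem_erase h1)).2
      rw [h2] at h3
      have := (hp v hv').2
      omega
    have h1 : (connSets T v).ncard = ∏ c ∈ insert (p v) (C v), (1 + sideCount T c v) := by
      refine ncard_connSets_eq_prod hT.isAcyclic v _ fun c => ?_
      simp only [C, Finset.mem_insert, Finset.mem_filter, Finset.mem_erase, Finset.mem_univ,
        and_true]
      constructor
      · rintro (rfl | ⟨h1, h2⟩)
        · exact (hp v hv').1
        · have := (hp c h1).1
          rw [h2] at this
          exact this.symm
      · intro h
        rcases hadj v c h with h | h
        · exact .inl h.2.symm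
        · exact .inr h
    -- Both expressions for N(T,v) contain the factor 1 + a(p v,v) of the parent; cancelling it
    -- leaves the children.
    rw [Finset.prod_insert hpv, ncard_connSets_eq_sideCount_mul hT.isAcyclic (hp v hv').1,
      mul_comm] at h1
    have h2 := Nat.eq_of_mul_eq_mul_left (by omega) h1
    rw [h2]
    push_cast
    rw [Real.log_prod fun c _ => by have := hpos c v; positivity]
    exact Finset.sum_congr rfl fun c hc => by rw [(Finset.mem_filter.1 hc).2]
  have hsum : ∑ v, ∑ c ∈ C v, Real.log (1 + sideCount T c (p c)) =
      ∑ c ∈ Finset.univ.erase r, Real.log (1 + sideCount T c (p c)) :=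
    Finset.sum_fiberwise (Finset.univ.erase r) p _
  rw [← Finset.add_sum_erase _ _ (Finset.mem_univ r), ← hroot, ← Finset.sum_congr rfl hnon] at hsum
  rw [eq_sub_of_add_eq hsum, ← Finset.sum_sub_distrib]
  refine Finset.sum_congr rfl fun v _ => ?_
  have := hpos v (p v)
  rw [← Real.log_div (by positivity) (by positivity)]
  congr 1
  field_simp
  ring

/-- Induction on the distance from r. For a child of r, maximality reads a(1 + b) ≤ b(1 + a) with a
= a(v,r), b = a(r,v), so a ≤ b. Otherwise, with u = p v and x = p u, the chain is a(v,u) < a(u,x) ≤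
a(x,u) < a(u,v). -/
theorem sideCount_parent_le {T : SimpleGraph V} (hT : T.IsTree) {r : V} {p : V → V}
    (hp : ∀ v, v ≠ r → T.Adj v (p v) ∧ T.dist r v = T.dist r (p v) + 1)
    (hr : ∀ v, (connSets T v).ncard ≤ (connSets T r).ncard) {v : V} (hv : v ≠ r) :
    sideCount T v (p v) ≤ sideCount T (p v) v := by
  induction hd : T.dist r v using Nat.strong_induction_on generalizing v with
  | _ d ih =>
    obtain ⟨h1, h2⟩ := hp v hv
    by_cases hpr : p v = r
    · have h3 := hr v
      rw [ncard_connSets_eq_sideCount_mul hT.isAcyclic h1, ← hpr,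
        ncard_connSets_eq_sideCount_mul hT.isAcyclic h1.symm] at h3
      linarith
    · obtain ⟨h3, h4⟩ := hp (p v) hpr
      have h5 := ih _ (by omega) hpr rfl
      have hne : v ≠ p (p v) := by
        intro h
        rw [← h] at h4
        omega
      have h6 := one_add_sideCount_le hT.isAcyclic h1.symm h3 hne
      have h7 := one_add_sideCount_le hT.isAcyclic h3 h1.symm hne.symm
      omega

theorem numSubtreesAt_deleteEdges {T : SimpleGraph V} (hT : T.IsAcyclic) (v w : V) :
    numSubtreesAt (T.deleteEdges {s(v, w)}) v = (sideCount T v w : ℕ∞) := by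
  rw [numSubtreesAt_eq_encard_connSets (hT.anti (T.deleteEdges_le _)), sideCount,
    (Set.toFinite _).cast_ncard_eq]

/-- For a neighbour w other than the parent, cutting vw keeps the parent's side: a(v,w) ≥ 1 + a(p
v,v) > a(v,p v). -/
theorem minSubtreesAt_eq_sideCount {T : SimpleGraph V} (hT : T.IsTree) {r : V} {p : V → V}
    (hp : ∀ v, v ≠ r → T.Adj v (p v) ∧ T.dist r v = T.dist r (p v) + 1)
    (hr : ∀ v, (connSets T v).ncard ≤ (connSets T r).ncard) {v : V} (hv : v ≠ r) :
    minSubtreesAt T v = (sideCount T v (p v) : ℕ∞) := by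
  refine le_antisymm ?_ (le_iInf₂ ?_)
  · rw [← numSubtreesAt_deleteEdges hT.isAcyclic]
    exact iInf₂_le _ ⟨(hp v hv).1, by simp⟩
  · rintro e ⟨he, hve⟩
    obtain ⟨w, rfl⟩ := Sym2.mem_iff_exists.1 hve
    rw [numSubtreesAt_deleteEdges hT.isAcyclic]
    have hvw : T.Adj v w := he
    by_cases hw : w = p v
    · rw [hw]
    · have h1 := one_add_sideCount_le hT.isAcyclic (hp v hv).1 hvw (Ne.symm hw)
      have h2 := sideCount_parent_le hT hp hr hv
      exact_mod_cast (by omega)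

end Finite

/-! ### The local functional and its truncation -/

/-- The function `log (1 + 1 / m)` of an extended natural number `m`. -/
noncomputable def logOneAddInv (m : ℕ∞) : ℝ :=
  Real.log (1 + ((m : ENNReal)⁻¹).toReal)

theorem logOneAddInv_nonneg (m : ℕ∞) : 0 ≤ logOneAddInv m :=
  Real.log_nonneg (by simp)

theorem logOneAddInv_natCast (n : ℕ) : logOneAddInv n = Real.log (1 + (n : ℝ)⁻¹) := by
  simp [logOneAddInv]

theorem logOneAddInv_le_inv {m : ℕ∞} {k : ℕ} (hk : 0 < k) (h : (k : ℕ∞) ≤ m) :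
    logOneAddInv m ≤ (k : ℝ)⁻¹ := by
  have h1 : ((m : ENNReal)⁻¹).toReal ≤ (k : ℝ)⁻¹ := by
    have h2 : (m : ENNReal)⁻¹ ≤ (k : ENNReal)⁻¹ := by
      rw [ENNReal.inv_le_inv]
      exact_mod_cast h
    have h3 : ((k : ENNReal)⁻¹) ≠ ⊤ := by simp [hk.ne']
    simpa using ENNReal.toReal_mono h3 h2
  have h4 := Real.log_le_sub_one_of_pos (x := 1 + ((m : ENNReal)⁻¹).toReal) (by positivity)
  unfold logOneAddInv
  linarith

theorem logOneAddInv_le_one (m : ℕ∞) : logOneAddInv m ≤ 1 := by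
  rcases eq_or_ne m 0 with rfl | h
  -- At m = 0 the inverse is ∞, which `toReal` sends to 0, so the value is log 1.
  · simp [logOneAddInv]
  · simpa using logOneAddInv_le_inv one_pos (by simpa using Order.one_le_iff_ne_zero.2 h)

theorem abs_logOneAddInv_min_sub_le (m : ℕ∞) (r : ℕ) :
    |logOneAddInv (min m (r + 1)) - logOneAddInv m| ≤ ((r : ℝ) + 1)⁻¹ := by
  rcases le_total m (r + 1) with h | h
  · rw [min_eq_left h, sub_self, abs_zero]
    positivity
  · rw [min_eq_right h]
    have h1 := logOneAddInv_le_inv (m := (r : ℕ∞) + 1) r.succ_pos (by push_cast; exact le_rfl)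
    have h2 := logOneAddInv_le_inv r.succ_pos (m := m) (by exact_mod_cast h)
    have h3 := logOneAddInv_nonneg m
    have h4 := logOneAddInv_nonneg ((r : ℕ∞) + 1)
    push_cast at h1 h2
    rw [abs_le]
    constructor <;> linarith

/-- `M(T, v)` is determined, up to truncation at `r + 1`, by the `r`-ball around `v`. -/
theorem min_minSubtrees_ball {V : Type u} {T : SimpleGraph V} (hT : T.IsAcyclic) (v : V) {r : ℕ}
    (hr : 1 ≤ r) : min ((rootedAt T v).ball r).minSubtrees (r + 1) =
      min (rootedAt T v).minSubtrees (r + 1) := by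
  set B := ballVerts T v r with hB
  have hv : v ∈ B := ⟨.nil, Nat.zero_le r⟩
  change min (minSubtreesAt (T.induce B) ⟨v, hv⟩) _ = min (minSubtreesAt T v) _
  have key : ∀ w : B, min (numSubtreesAt ((T.induce B).deleteEdges {s(⟨v, hv⟩, w)}) ⟨v, hv⟩)
      ((r : ℕ∞) + 1) = min (numSubtreesAt (T.deleteEdges {s(v, w.1)}) v) (r + 1) := by
    intro w
    have h1 : (T.induce B).deleteEdges {s(⟨v, hv⟩, w)} = (T.deleteEdges {s(v, w.1)}).induce B := by
      ext a b
      simp [SimpleGraph.deleteEdges_adj, Subtype.ext_iff]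
    have h2 : (T.deleteEdges {s(v, w.1)}).IsAcyclic := hT.anti (T.deleteEdges_le _)
    rw [h1, numSubtreesAt_eq_encard_connSets (h2.induce B), numSubtreesAt_eq_encard_connSets h2]
    refine min_encard_connSets_induce hv ?_
    rintro x ⟨p, hp⟩
    exact ⟨p.mapLe (T.deleteEdges_le _), by simpa using hp⟩
  apply le_antisymm <;> refine le_min (le_iInf₂ ?_) (min_le_right _ _) <;> rintro e ⟨he, hve⟩ <;>
    obtain ⟨w, rfl⟩ := Sym2.mem_iff_exists.1 hve
  · have hvw : T.Adj v w := he
    -- Radius at least 1 ensures that all edges at v survive in the ball.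
    have hw : w ∈ B := ⟨hvw.toWalk, by simpa using hr⟩
    calc _ ≤ min (numSubtreesAt ((T.induce B).deleteEdges {s(⟨v, hv⟩, ⟨w, hw⟩)}) ⟨v, hv⟩)
          ((r : ℕ∞) + 1) := min_le_min_right _ (iInf₂_le _ ⟨hvw, by simp⟩)
      _ = _ := key ⟨w, hw⟩
      _ ≤ _ := min_le_left _ _
  · have hvw : T.Adj v w := he
    calc _ ≤ min (numSubtreesAt (T.deleteEdges {s(v, w.1)}) v) ((r : ℕ∞) + 1) :=
          min_le_min_right _ (iInf₂_le _ ⟨hvw, by simp⟩)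
      _ = _ := (key w).symm
      _ ≤ _ := min_le_left _ _

theorem ncard_subtrees_containing {V : Type u} {T : SimpleGraph V} (hT : T.IsAcyclic) (v : V) :
    {S : T.Subgraph | S.coe.IsTree ∧ v ∈ S.verts}.ncard = (connSets T v).ncard := by
  rw [Set.ncard_def, Set.ncard_def, ← numSubtreesAt_eq_encard_connSets hT, numSubtreesAt]

/-! ### All subtrees versus subtrees through the root -/

section Finite

variable {V : Type u} [Finite V]

theorem ncard_connSets_le_numSubtrees {T : SimpleGraph V} (hT : T.IsAcyclic) (v : V) :
    (connSets T v).ncard ≤ numSubtrees T := by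
  rw [← ncard_subtrees_containing hT]
  exact Set.ncard_le_ncard (fun S hS => hS.1) (Set.toFinite _)

theorem numSubtrees_le {T : SimpleGraph V} (hT : T.IsAcyclic) {k : ℕ}
    (hk : ∀ v, (connSets T v).ncard ≤ k) : numSubtrees T ≤ Nat.card V * k := by
  have := Fintype.ofFinite V
  have h1 : {S : T.Subgraph | S.coe.IsTree} ⊆
      ⋃ v, {S : T.Subgraph | S.coe.IsTree ∧ v ∈ S.verts} := by
    intro S hS
    obtain ⟨v⟩ := (show S.coe.IsTree from hS).connected.nonempty
    exact Set.mem_iUnion.2 ⟨v.1, hS, v.2⟩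
  calc numSubtrees T ≤ _ := Set.ncard_le_ncard h1 (Set.toFinite _)
    _ ≤ ∑ v, {S : T.Subgraph | S.coe.IsTree ∧ v ∈ S.verts}.ncard :=
        Set.ncard_iUnion_le_of_fintype _
    _ ≤ ∑ _v : V, k := Finset.sum_le_sum fun v _ => by
        rw [ncard_subtrees_containing hT]; exact hk v
    _ = _ := by simp [Nat.card_eq_fintype_card]

/-- The logarithm of the number of subtrees is, up to a logarithmic error, the sum of the local
contributions `log (1 + 1 / M(T, v))`. -/
theorem abs_log_numSubtrees_sub_sum_le {V : Type u} [Fintype V] {T : SimpleGraph V}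
    (hT : T.IsTree) : |Real.log (numSubtrees T) - ∑ v, logOneAddInv (minSubtreesAt T v)| ≤
      Real.log (Nat.card V) + 1 := by
  classical
  have := hT.connected.nonempty
  obtain ⟨r, hr⟩ := Finite.exists_max fun v => (connSets T v).ncard
  obtain ⟨p, hp, hadj⟩ := hT.exists_parent r
  -- Only the term of the root is not accounted for by the telescoped sum; it lies in [0, 1].
  have h1 : ∑ v, logOneAddInv (minSubtreesAt T v) =
      logOneAddInv (minSubtreesAt T r) + Real.log (connSets T r).ncard := by
    rw [← Finset.add_sum_erase _ _ (Finset.mem_univ r), log_ncard_connSets_eq_sum hT hp hadj]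
    congr 1
    refine Finset.sum_congr rfl fun v hv => ?_
    rw [minSubtreesAt_eq_sideCount hT hp hr (Finset.ne_of_mem_erase hv), logOneAddInv_natCast]
  have hr0 : (0 : ℝ) < (connSets T r).ncard := by exact_mod_cast ncard_connSets_pos T r
  have hV : (0 : ℝ) < Nat.card V := by exact_mod_cast Nat.card_pos
  have h2 : Real.log (connSets T r).ncard ≤ Real.log (numSubtrees T) :=
    Real.log_le_log hr0 (by exact_mod_cast ncard_connSets_le_numSubtrees hT.isAcyclic r)
  have h3 : Real.log (numSubtrees T) ≤ Real.log (Nat.card V) + Real.log (connSets T r).ncard := by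
    rw [← Real.log_mul hV.ne' hr0.ne']
    refine Real.log_le_log ?_ (by exact_mod_cast numSubtrees_le hT.isAcyclic hr)
    exact hr0.trans_le (by exact_mod_cast ncard_connSets_le_numSubtrees hT.isAcyclic r)
  have h4 := logOneAddInv_nonneg (minSubtreesAt T r)
  have h5 := logOneAddInv_le_one (minSubtreesAt T r)
  have h6 : 0 ≤ Real.log (Nat.card V) := Real.log_natCast_nonneg _
  rw [h1, abs_le]
  constructor <;> linarith

end Finite

/-! ### Balls and their isomorphism classes -/

section Balls

variable {V W : Type u} {G : SimpleGraph V} {H : SimpleGraph W}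

theorem root_mem_ballVerts (G : SimpleGraph V) (v : V) (r : ℕ) : v ∈ ballVerts G v r :=
  ⟨.nil, Nat.zero_le r⟩

theorem ballVerts_mono (G : SimpleGraph V) (v : V) : Monotone (ballVerts G v) := by
  rintro r r' h x ⟨p, hp⟩
  exact ⟨p, hp.trans h⟩

theorem ballVerts_zero (G : SimpleGraph V) (v : V) : ballVerts G v 0 = {v} := by
  ext x
  constructor
  · rintro ⟨p, hp⟩
    exact (SimpleGraph.Walk.eq_of_length_eq_zero (Nat.le_zero.1 hp)).symm
  · rintro rfl
    exact root_mem_ballVerts G _ 0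

theorem adj_mem_ballVerts_succ {v x y : V} {r : ℕ} (hx : x ∈ ballVerts G v r) (h : G.Adj x y) :
    y ∈ ballVerts G v (r + 1) := by
  obtain ⟨p, hp⟩ := hx
  exact ⟨p.concat h, by simpa using hp⟩

theorem mem_ballVerts_succ {v x : V} {r : ℕ} (hx : x ∈ ballVerts G v (r + 1)) :
    x ∈ ballVerts G v r ∨ ∃ y ∈ ballVerts G v r, G.Adj y x := by
  obtain ⟨p, hp⟩ := hx
  by_cases hnil : p.Nil
  · exact .inl ⟨p, by simp [SimpleGraph.Walk.length_eq_zero_iff.2 hnil]⟩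
  · refine .inr ⟨_, ⟨p.dropLast, ?_⟩, p.adj_penultimate hnil⟩
    have := p.length_dropLast_add_one hnil
    omega

/-- A map that is bijective on neighbourhoods inside a ball maps balls onto balls. -/
theorem image_ballVerts {f : V → W} {v : V} {R : ℕ}
    (h : ∀ r < R, ∀ x ∈ ballVerts G v r, f '' G.neighborSet x = H.neighborSet (f x)) :
    ∀ r ≤ R, f '' ballVerts G v r = ballVerts H (f v) r := by
  intro r
  induction r with
  | zero => simp [ballVerts_zero]
  | succ r ih =>
    intro hr
    have ih := ih (by omega)
    ext y
    constructor
    · rintro ⟨x, hx, rfl⟩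
      rcases mem_ballVerts_succ hx with hx | ⟨z, hz, hzx⟩
      · exact ballVerts_mono H _ r.le_succ (ih ▸ ⟨x, hx, rfl⟩)
      · have h1 : f z ∈ ballVerts H (f v) r := ih ▸ ⟨z, hz, rfl⟩
        have h2 : f x ∈ H.neighborSet (f z) := h r (by omega) z hz ▸ ⟨x, hzx, rfl⟩
        exact adj_mem_ballVerts_succ h1 h2
    · intro hy
      rcases mem_ballVerts_succ hy with hy | ⟨z, hz, hzy⟩
      · rw [← ih] at hy
        obtain ⟨x, hx, rfl⟩ := hy
        exact ⟨x, ballVerts_mono G _ r.le_succ hx, rfl⟩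
      · rw [← ih] at hz
        obtain ⟨x, hx, rfl⟩ := hz
        have h2 : y ∈ H.neighborSet (f x) := hzy
        rw [← h r (by omega) x hx] at h2
        obtain ⟨t, ht, rfl⟩ := h2
        exact ⟨t, adj_mem_ballVerts_succ hx ht, rfl⟩

/-- Criterion for two rooted graphs to have isomorphic balls. -/
theorem ball_rootedAt_eq {f : V → W} {v : V} {w : W} (hw : f v = w) {r : ℕ}
    (hinj : Set.InjOn f (ballVerts G v r)) (himg : f '' ballVerts G v r = ballVerts H w r)
    (hadj : ∀ a ∈ ballVerts G v r, ∀ b ∈ ballVerts G v r, G.Adj a b ↔ H.Adj (f a) (f b)) :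
    (rootedAt G v).ball r = (rootedAt H w).ball r := by
  subst hw
  have hbij : Set.BijOn f (ballVerts G v r) (ballVerts H (f v) r) := himg ▸ hinj.bijOn_image
  refine Quotient.sound ⟨{ toEquiv := hbij.equiv f, map_rel_iff' := ?_ }, rfl⟩
  rintro ⟨a, ha⟩ ⟨b, hb⟩
  exact (hadj a ha b hb).symm

theorem ballVerts_subset_of_adj {G G' : SimpleGraph V} {v : V} {n : ℕ}
    (h : ∀ a ∈ ballVerts G v n, ∀ b ∈ ballVerts G v n, G.Adj a b → G'.Adj a b) :
    ∀ r ≤ n, ballVerts G v r ⊆ ballVerts G' v r := by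
  intro r
  induction r with
  | zero => simp [ballVerts_zero]
  | succ r ih =>
    intro hr x hx
    rcases mem_ballVerts_succ hx with hx' | ⟨z, hz, hzx⟩
    · exact ballVerts_mono G' v r.le_succ (ih (by omega) hx')
    · exact adj_mem_ballVerts_succ (ih (by omega) hz)
        (h z (ballVerts_mono G v (by omega) hz) x (ballVerts_mono G v hr hx) hzx)

end Balls

/-- A vertex at distance less than r' keeps all its neighbours in the r'-ball, so distances up to r'
from the root are the same there. -/
theorem RGClass.ball_ball {r r' : ℕ} (h : r ≤ r') (x : RGClass.{u}) :
    (x.ball r').ball r = x.ball r := by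
  induction x using Quotient.ind with
  | _ K =>
    obtain ⟨V, G, v⟩ := K
    have hval : ∀ k ≤ r', ∀ x : ballVerts G v r',
        x ∈ ballVerts (G.induce (ballVerts G v r')) ⟨v, root_mem_ballVerts G v r'⟩ k →
          x.1 ∈ ballVerts G v k := by
      rintro k - x ⟨p, hp⟩
      exact ⟨p.map (SimpleGraph.Embedding.induce _).toHom,
        (SimpleGraph.Walk.length_map _ p).trans_le hp⟩
    have himg := image_ballVerts (G := G.induce (ballVerts G v r')) (H := G) (f := Subtype.val)
      (v := ⟨v, root_mem_ballVerts G v r'⟩) (R := r') ?_ r h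
    · exact ball_rootedAt_eq (G := G.induce (ballVerts G v r')) (H := G) (f := Subtype.val)
        (v := ⟨v, root_mem_ballVerts G v r'⟩) rfl Subtype.val_injective.injOn himg
        fun a _ b _ => Iff.rfl
    · intro k hk x hx
      ext y
      constructor
      · rintro ⟨z, hz, rfl⟩
        exact hz
      · intro hy
        exact ⟨⟨y, ballVerts_mono G v hk (adj_mem_ballVerts_succ (hval k hk.le x hx) hy)⟩, hy, rfl⟩

/-! ### Gluing coherent balls to a locally finite tree -/

/-- One step of the construction of a limit tree: a graph whose `n`-ball around `w` is given is
changed outside this ball so that it has a given `(n + 1)`-ball. -/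
theorem exists_extend_ball {W : Type u} [Infinite W] {w : W} {n : ℕ} {G : SimpleGraph W}
    {K : RootedGraph.{u}} [Finite K.V]
    (hK : RGClass.ball n (Quotient.mk _ K) = (rootedAt G w).ball n) :
    ∃ G' : SimpleGraph W, (rootedAt G' w).ball (n + 1) = RGClass.ball (n + 1) (Quotient.mk _ K) ∧
      (∀ r ≤ n, ballVerts G' w r = ballVerts G w r) ∧
      ∀ a ∈ ballVerts G w n, ∀ b ∈ ballVerts G w n, G'.Adj a b ↔ G.Adj a b := by
  classical
  obtain ⟨V, K, v⟩ := K
  change Finite V at *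
  obtain ⟨φ, hφ⟩ : ∃ φ : K.induce (ballVerts K v n) ≃g G.induce (ballVerts G w n),
    φ ⟨v, root_mem_ballVerts K v n⟩ = ⟨w, root_mem_ballVerts G w n⟩ := Quotient.exact hK
  have hfin : (ballVerts G w n).Finite := Set.finite_coe_iff.1 (Finite.of_equiv _ φ.toEquiv)
  have : Infinite ↥(ballVerts G w n)ᶜ := hfin.infinite_compl.to_subtype
  -- The new vertices of K are placed outside the old ball, where an infinite W always has room. The
  -- graph G' is the copy of K, and whatever G had outside its ball is discarded.
  let e : V ↪ ↥(ballVerts G w n)ᶜ := (Finite.equivFin V).toEmbedding.trans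
    (Fin.valEmbedding.trans (Infinite.natEmbedding _))
  let ι : V → W := fun x => if h : x ∈ ballVerts K v n then (φ ⟨x, h⟩).1 else (e x).1
  have hι : ∀ x (h : x ∈ ballVerts K v n), ι x = (φ ⟨x, h⟩).1 := fun x h => dif_pos h
  have hι' : ∀ x, x ∉ ballVerts K v n → ι x = (e x).1 := fun x h => dif_neg h
  have hinj : Function.Injective ι := by
    intro x y hxy
    by_cases hx : x ∈ ballVerts K v n <;> by_cases hy : y ∈ ballVerts K v n
    · rw [hι x hx, hι y hy] at hxy
      exact congrArg Subtype.val (φ.injective (Subtype.ext hxy))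
    · rw [hι x hx, hι' y hy] at hxy
      exact ((e y).2 (hxy ▸ (φ ⟨x, hx⟩).2)).elim
    · rw [hι' x hx, hι y hy] at hxy
      exact ((e x).2 (hxy ▸ (φ ⟨y, hy⟩).2)).elim
    · rw [hι' x hx, hι' y hy] at hxy
      exact e.injective (Subtype.ext hxy)
  have hw : ι v = w := by rw [hι v (root_mem_ballVerts K v n), hφ]
  let G' : SimpleGraph W := K.map ι
  have hG' : ∀ a b, G'.Adj (ι a) (ι b) ↔ K.Adj a b := fun a b =>
    SimpleGraph.map_adj_apply (f := (⟨ι, hinj⟩ : V ↪ W))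
  have himg : ∀ r, ι '' ballVerts K v r = ballVerts G' w r := by
    intro r
    rw [← hw]
    refine image_ballVerts (R := r) (fun k _ x _ => ?_) r le_rfl
    ext y
    constructor
    · rintro ⟨z, hz, rfl⟩
      exact (hG' x z).2 hz
    · rintro ⟨-, a, b, hab, h1, rfl⟩
      exact ⟨b, by rwa [hinj h1] at hab, rfl⟩
  have hball : ballVerts G' w n = ballVerts G w n := by
    rw [← himg]
    ext y
    constructor
    · rintro ⟨x, hx, rfl⟩
      rw [hι x hx]
      exact (φ ⟨x, hx⟩).2
    · intro hy
      refine ⟨(φ.symm ⟨y, hy⟩).1, (φ.symm ⟨y, hy⟩).2, ?_⟩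
      rw [hι _ (φ.symm ⟨y, hy⟩).2]
      simp
  have hadj : ∀ a ∈ ballVerts G w n, ∀ b ∈ ballVerts G w n, G'.Adj a b ↔ G.Adj a b := by
    intro a ha b hb
    rw [← hball, ← himg] at ha hb
    obtain ⟨x, hx, rfl⟩ := ha
    obtain ⟨y, hy, rfl⟩ := hb
    rw [hG', hι x hx, hι y hy]
    exact (φ.map_adj_iff (v := ⟨x, hx⟩) (w := ⟨y, hy⟩)).symm
  refine ⟨G', ?_, ?_, hadj⟩
  · exact (ball_rootedAt_eq hw hinj.injOn (himg _) fun a _ b _ => (hG' a b).symm).symm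
  · intro r hr
    refine (ballVerts_subset_of_adj (fun a ha b hb h => ?_) r hr).antisymm
      (ballVerts_subset_of_adj (fun a ha b hb h => (hadj a ha b hb).2 h) r hr)
    rw [hball] at ha hb
    exact (hadj a ha b hb).1 h

/-- `H` is the `r`-ball around some vertex of a finite tree. -/
def IsFiniteTreeBall (r : ℕ) (H : RGClass.{u}) : Prop :=
  ∃ (V : Type u) (T : SimpleGraph V) (v : V), Finite V ∧ T.IsTree ∧ H = (rootedAt T v).ball r

theorem IsFiniteTreeBall.ball_eq {r : ℕ} {H : RGClass.{u}} (h : IsFiniteTreeBall r H) :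
    H.ball r = H := by
  obtain ⟨V, T, v, -, -, rfl⟩ := h
  exact RGClass.ball_ball le_rfl _

theorem IsFiniteTreeBall.exists_rep {r : ℕ} {H : RGClass.{u}} (h : IsFiniteTreeBall r H) :
    ∃ K : RootedGraph.{u}, Finite K.V ∧ K.graph.IsAcyclic ∧ H = Quotient.mk _ K := by
  obtain ⟨V, T, v, _, hT, rfl⟩ := h
  exact ⟨RootedGraph.ball r ⟨V, T, v⟩, inferInstanceAs (Finite (ballVerts T v r)),
    hT.isAcyclic.induce _, rfl⟩

/-- A coherent sequence of balls is realised by a sequence of graphs on a fixed vertex set, each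
agreeing with the next on its ball. -/
theorem exists_seq_of_coherent {H : ℕ → RGClass.{u}} (hH : ∀ n, IsFiniteTreeBall n (H n))
    (hcoh : ∀ n, (H (n + 1)).ball n = H n) :
    ∃ (W : Type u) (w : W) (G : ℕ → SimpleGraph W), (∀ n, (rootedAt (G n) w).ball n = H n) ∧
      (∀ n, ∀ r ≤ n, ballVerts (G (n + 1)) w r = ballVerts (G n) w r) ∧
      ∀ n, ∀ a ∈ ballVerts (G n) w n, ∀ b ∈ ballVerts (G n) w n,
        (G (n + 1)).Adj a b ↔ (G n).Adj a b := by
  let W := ULift.{u} ℕ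
  let w : W := ⟨0⟩
  have h0 : (rootedAt (⊥ : SimpleGraph W) w).ball 0 = H 0 := by
    obtain ⟨V, T, v, -, -, h⟩ := hH 0
    rw [h]
    symm
    refine ball_rootedAt_eq (f := fun _ => w) rfl ?_ ?_ ?_
    · simp [ballVerts_zero]
    · simp [ballVerts_zero]
    · intro a ha b hb
      rw [ballVerts_zero] at ha hb
      rw [ha, hb]
      simp
  have hstep : ∀ n (G : SimpleGraph W), (rootedAt G w).ball n = H n → ∃ G' : SimpleGraph W,
      (rootedAt G' w).ball (n + 1) = H (n + 1) ∧
      (∀ r ≤ n, ballVerts G' w r = ballVerts G w r) ∧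
      ∀ a ∈ ballVerts G w n, ∀ b ∈ ballVerts G w n, G'.Adj a b ↔ G.Adj a b := by
    intro n G hG
    obtain ⟨K, hK, -, h⟩ := (hH (n + 1)).exists_rep
    have h1 := exists_extend_ball (G := G) (w := w) (K := K) (n := n) (by rw [← h, hcoh, hG])
    rwa [← h, (hH (n + 1)).ball_eq] at h1
  let F : ∀ n, {G : SimpleGraph W // (rootedAt G w).ball n = H n} := fun n =>
    Nat.rec ⟨⊥, h0⟩ (fun n G => ⟨(hstep n G.1 G.2).choose, (hstep n G.1 G.2).choose_spec.1⟩) n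
  exact ⟨W, w, fun n => (F n).1, fun n => (F n).2,
    fun n => (hstep n (F n).1 (F n).2).choose_spec.2.1,
    fun n => (hstep n (F n).1 (F n).2).choose_spec.2.2⟩

/-- A cycle has finitely many vertices, so it would already lie in some ball. -/
theorem isTree_of_forall_ball {V : Type u} {G : SimpleGraph V} {v : V}
    (hcover : ∀ x, ∃ n, x ∈ ballVerts G v n)
    (hball : ∀ n, (G.induce (ballVerts G v n)).IsAcyclic) : G.IsTree := by
  have hreach : ∀ x, G.Reachable v x := fun x => by
    obtain ⟨n, p, -⟩ := hcover x
    exact ⟨p⟩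
  refine ⟨{ preconnected := fun x y => (hreach x).symm.trans (hreach y), nonempty := ⟨v⟩ }, ?_⟩
  intro x c hc
  choose n hn using hcover
  obtain ⟨N, hN⟩ := (c.support.map n).toFinset.exists_le
  have hsupp : ∀ y ∈ c.support, y ∈ ballVerts G v N := fun y hy =>
    ballVerts_mono G v (hN (n y) (by simpa using ⟨y, hy, rfl⟩)) (hn y)
  refine hball N (c.induce _ hsupp) ?_
  rw [← SimpleGraph.Walk.map_induce c hsupp] at hc
  exact hc.of_map

/-- A coherent sequence of balls of finite trees is the sequence of balls of a locally finite
rooted tree. -/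
theorem exists_lfRootedTree {H : ℕ → RGClass.{u}} (hH : ∀ n, IsFiniteTreeBall n (H n))
    (hcoh : ∀ n, (H (n + 1)).ball n = H n) :
    ∃ x : LFRootedTree.{u}, ∀ n, x.1.ball n = H n := by
  obtain ⟨W, w, G, hG, hverts, hadj⟩ := exists_seq_of_coherent hH hcoh
  have hverts' : ∀ n m, n ≤ m → ∀ r ≤ n, ballVerts (G m) w r = ballVerts (G n) w r := by
    intro n m hnm r hr
    induction m, hnm using Nat.le_induction with
    | base => rfl
    | succ m hnm ih => rw [hverts m r (hr.trans hnm), ih]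
  have hadj' : ∀ n m, n ≤ m → ∀ a ∈ ballVerts (G n) w n, ∀ b ∈ ballVerts (G n) w n,
      ((G m).Adj a b ↔ (G n).Adj a b) := by
    intro n m hnm a ha b hb
    have hsub : ∀ m, n ≤ m → ballVerts (G n) w n ⊆ ballVerts (G m) w m := fun m hm =>
      (hverts' n m hm n le_rfl).symm.subset.trans (ballVerts_mono _ _ hm)
    induction m, hnm using Nat.le_induction with
    | base => rfl
    | succ m hnm ih => exact (hadj m a (hsub m hnm ha) b (hsub m hnm hb)).trans ih
  let L : SimpleGraph W :=
    { Adj := fun a b => ∃ n, a ∈ ballVerts (G n) w n ∧ b ∈ ballVerts (G n) w n ∧ (G n).Adj a b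
      symm := ⟨fun a b ⟨n, ha, hb, h⟩ => ⟨n, hb, ha, h.symm⟩⟩
      loopless := ⟨fun a ⟨n, _, _, h⟩ => h.ne rfl⟩ }
  have hL : ∀ n, ∀ a ∈ ballVerts (G n) w n, ∀ b ∈ ballVerts (G n) w n,
      (L.Adj a b ↔ (G n).Adj a b) := by
    intro n a ha b hb
    refine ⟨?_, fun h => ⟨n, ha, hb, h⟩⟩
    rintro ⟨m, ha', hb', h⟩
    rcases le_total n m with hnm | hnm
    · exact (hadj' n m hnm a ha b hb).1 h
    · exact (hadj' m n hnm a ha' b hb').2 h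
  -- Inner vertices of the n-ball gain no neighbours at later stages, so the limit L has the
  -- prescribed balls.
  have hnbr : ∀ n, ∀ r < n, ∀ x ∈ ballVerts (G n) w r, ∀ y, L.Adj x y →
      y ∈ ballVerts (G n) w (r + 1) := by
    rintro n r hr x hx y ⟨m, hxm, hym, h⟩
    rcases le_total n m with hnm | hnm
    · rw [← hverts' n m hnm r hr.le] at hx
      rw [← hverts' n m hnm _ hr]
      exact adj_mem_ballVerts_succ hx h
    · have hsub : ballVerts (G m) w m ⊆ ballVerts (G n) w n :=
        (hverts' m n hnm m le_rfl).symm.subset.trans (ballVerts_mono _ _ hnm)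
      exact adj_mem_ballVerts_succ hx
        ((hadj' m n hnm x hxm y hym).2 h)
  have hballL : ∀ n, ballVerts L w n = ballVerts (G n) w n := by
    intro n
    have := image_ballVerts (G := G n) (H := L) (f := id) (v := w) (R := n) (fun r hr x hx => by
      rw [Set.image_id]
      ext y
      have hxn := ballVerts_mono (G n) w hr.le hx
      constructor
      · intro h
        exact (hL n x hxn y (ballVerts_mono (G n) w hr (adj_mem_ballVerts_succ hx h))).2 h
      · intro h
        exact (hL n x hxn y (ballVerts_mono (G n) w hr (hnbr n r hr x hx y h))).1 h) n le_rfl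
    simpa using this.symm
  have hballL' : ∀ n, (rootedAt L w).ball n = H n := by
    intro n
    rw [← hG n]
    refine (ball_rootedAt_eq (f := id) rfl Function.injective_id.injOn ?_ ?_).symm
    · rw [Set.image_id, id, hballL]
    · exact fun a ha b hb => (hL n a ha b hb).symm
  -- Vertices of W that are never reached are isolated in L; the tree is the component of w.
  let U : Set W := {x | ∃ n, x ∈ ballVerts L w n}
  have hwU : w ∈ U := ⟨0, root_mem_ballVerts L w 0⟩
  have himg : ∀ n, Subtype.val '' ballVerts (L.induce U) ⟨w, hwU⟩ n = ballVerts L w n := fun n =>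
    image_ballVerts (G := L.induce U) (H := L) (f := Subtype.val) (v := ⟨w, hwU⟩) (R := n)
      (fun r hr x hx => by
        ext y
        constructor
        · rintro ⟨z, hz, rfl⟩
          exact hz
        · intro hy
          obtain ⟨k, hk⟩ := x.2
          exact ⟨⟨y, k + 1, adj_mem_ballVerts_succ hk hy⟩, hy, rfl⟩) n le_rfl
  have hball : ∀ n, (rootedAt (L.induce U) ⟨w, hwU⟩).ball n = H n := by
    intro n
    rw [← hballL' n]
    exact ball_rootedAt_eq (f := Subtype.val) rfl Subtype.val_injective.injOn (himg n)
      fun a _ b _ => Iff.rfl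
  have hrep : ∀ n, Finite (ballVerts (L.induce U) ⟨w, hwU⟩ n) ∧
      ((L.induce U).induce (ballVerts (L.induce U) ⟨w, hwU⟩ n)).IsAcyclic := by
    intro n
    obtain ⟨K, hK, hKa, h⟩ := (hH n).exists_rep
    obtain ⟨φ, -⟩ : ∃ φ : (RootedGraph.ball n ⟨U, L.induce U, ⟨w, hwU⟩⟩).graph ≃g K.graph,
      φ (RootedGraph.ball n ⟨U, L.induce U, ⟨w, hwU⟩⟩).root = K.root :=
        Quotient.exact ((hball n).trans h)
    exact ⟨Finite.of_equiv _ φ.symm.toEquiv, φ.isAcyclic_iff.2 hKa⟩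
  have hcover : ∀ x : U, ∃ n, x ∈ ballVerts (L.induce U) ⟨w, hwU⟩ n := by
    rintro ⟨x, n, hx⟩
    rw [← himg n] at hx
    obtain ⟨y, hy, rfl⟩ := hx
    exact ⟨n, hy⟩
  refine ⟨⟨rootedAt (L.induce U) ⟨w, hwU⟩, U, L.induce U, ⟨w, hwU⟩,
    isTree_of_forall_ball hcover fun n => (hrep n).2, fun x => ?_, rfl⟩, hball⟩
  obtain ⟨n, hn⟩ := hcover x
  exact (Set.finite_coe_iff.1 (hrep (n + 1)).1).subset fun y hy => adj_mem_ballVerts_succ hn hy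

/-! ### Convergence of ball statistics -/

/-- Pointwise convergence of probability distributions to a probability distribution implies
convergence of the expectations of bounded functions. -/
theorem tendsto_tsum_mul_of_hasSum_one {ι : Type*} {a : ℕ → ι → ℝ} {s : ι → ℝ}
    (ha0 : ∀ n i, 0 ≤ a n i) (ha : ∀ n, HasSum (a n) 1) (hs : HasSum s 1)
    (h : ∀ i, Tendsto (fun n => a n i) atTop (𝓝 (s i))) {F : ι → ℝ} {C : ℝ}
    (hF : ∀ i, |F i| ≤ C) :
    Tendsto (fun n => ∑' i, a n i * F i) atTop (𝓝 (∑' i, s i * F i)) := by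
  have hs0 : ∀ i, 0 ≤ s i := fun i => ge_of_tendsto' (h i) fun n => ha0 n i
  have hmin : Tendsto (fun n => ∑' i, min (a n i) (s i)) atTop (𝓝 (∑' i, s i)) := by
    refine tendsto_tsum_of_dominated_convergence hs.summable (fun i => ?_)
      (.of_forall fun n i => ?_)
    · simpa using (h i).min (tendsto_const_nhds (x := s i))
    · rw [Real.norm_of_nonneg (le_min (ha0 n i) (hs0 i))]
      exact min_le_right _ _
  have hsm : ∀ n, Summable fun i => min (a n i) (s i) := fun n =>
    Summable.of_nonneg_of_le (fun i => le_min (ha0 n i) (hs0 i)) (fun i => min_le_right _ _)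
      hs.summable
  -- Scheffé's argument: |a - s| = a + s - 2 min(a, s), and the minima are dominated by s, so the ℓ¹
  -- distance tends to 0.
  have habs : ∀ n, HasSum (fun i => |a n i - s i|) (2 - 2 * ∑' i, min (a n i) (s i)) := by
    intro n
    have h1 := ((ha n).add hs).sub ((hsm n).hasSum.mul_left 2)
    convert! h1 using 1
    · ext i
      rcases le_total (a n i) (s i) with h | h
      · rw [min_eq_left h, abs_of_nonpos (by linarith)]; ring
      · rw [min_eq_right h, abs_of_nonneg (by linarith)]; ring
    · norm_num
  have hlim : Tendsto (fun n => C * (2 - 2 * ∑' i, min (a n i) (s i))) atTop (𝓝 0) := by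
    rw [hs.tsum_eq] at hmin
    have := (((hmin.const_mul 2).const_sub 2).const_mul C)
    simpa using this
  have hsF : ∀ b : ι → ℝ, Summable b → (∀ i, 0 ≤ b i) → Summable fun i => b i * F i := by
    intro b hb hb0
    refine Summable.of_norm_bounded (hb.mul_right C) fun i => ?_
    rw [norm_mul, Real.norm_of_nonneg (hb0 i)]
    exact mul_le_mul_of_nonneg_left (hF i) (hb0 i)
  rw [tendsto_iff_norm_sub_tendsto_zero]
  refine squeeze_zero (fun n => norm_nonneg _) (fun n => ?_) hlim
  rw [← (hsF _ (ha n).summable (ha0 n)).tsum_sub (hsF _ hs.summable hs0), mul_comm]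
  refine tsum_of_norm_bounded ((habs n).mul_right C) fun i => ?_
  rw [← sub_mul, norm_mul]
  exact mul_le_mul_of_nonneg_left (hF i) (abs_nonneg _)

theorem ballFreq_nonneg {V : Type u} (G : SimpleGraph V) (r : ℕ) (H : RGClass.{u}) :
    0 ≤ ballFreq G r H := by
  unfold ballFreq
  positivity

/-- Turns sums over ball classes into averages over vertices; each vertex contributes 1/|V| at the
class of its own ball. -/
theorem hasSum_ballFreq_mul {V : Type u} [Fintype V] (G : SimpleGraph V) (r : ℕ)
    (F : RGClass.{u} → ℝ) :
    HasSum (fun H => ballFreq G r H * F H)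
      ((∑ v, F ((rootedAt G v).ball r)) / (Nat.card V : ℝ)) := by
  classical
  have h1 : ∀ H, ballFreq G r H * F H =
      ∑ v, if H = (rootedAt G v).ball r then
        F ((rootedAt G v).ball r) / (Nat.card V : ℝ) else 0 := by
    intro H
    have h2 : {v : V | (rootedAt G v).ball r = H}.ncard =
        (Finset.univ.filter fun v : V => H = (rootedAt G v).ball r).card := by
      rw [← Set.ncard_coe_finset]
      congr 1
      ext v
      simp [eq_comm]
    rw [← Finset.sum_filter, ballFreq, h2,
      Finset.sum_congr rfl (g := fun _ => F H / (Nat.card V : ℝ))]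
    · rw [Finset.sum_const, nsmul_eq_mul]
      ring
    · intro v hv
      rw [← (Finset.mem_filter.1 hv).2]
  simp_rw [h1, Finset.sum_div]
  exact hasSum_sum fun v _ => hasSum_ite_eq _ _

theorem hasSum_ballFreq {V : Type u} [Finite V] [Nonempty V] (G : SimpleGraph V) (r : ℕ) :
    HasSum (ballFreq G r) 1 := by
  have := Fintype.ofFinite V
  simpa using hasSum_ballFreq_mul G r fun _ => 1

theorem BSConvergesTo.nonneg {V : ℕ → Type u} {T : ∀ n, SimpleGraph (V n)}
    {s : ℕ → RGClass.{u} → ℝ} (hs : BSConvergesTo T s) (r : ℕ) (H : RGClass.{u}) : 0 ≤ s r H :=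
  ge_of_tendsto' (hs.1 r H) fun n => ballFreq_nonneg (T n) r H

section Limit

variable {V : ℕ → Type u} [∀ n, Finite (V n)] {T : ∀ n, SimpleGraph (V n)}
  {s : ℕ → RGClass.{u} → ℝ}

theorem BSConvergesTo.tendsto_tsum [∀ n, Nonempty (V n)] (hs : BSConvergesTo T s) (r : ℕ)
    {F : RGClass.{u} → ℝ} {C : ℝ} (hF : ∀ H, |F H| ≤ C) :
    Tendsto (fun n => ∑' H, ballFreq (T n) r H * F H) atTop (𝓝 (∑' H, s r H * F H)) :=
  tendsto_tsum_mul_of_hasSum_one (fun n => ballFreq_nonneg (T n) r)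
    (fun n => hasSum_ballFreq (T n) r) (hs.2 r) (hs.1 r) hF

-- Consistency of the limit statistics in the radius. It is exact for each finite graph and passes
-- to the limit because no mass is lost.
open Classical in
theorem BSConvergesTo.tsum_ball_eq [∀ n, Nonempty (V n)] (hs : BSConvergesTo T s) (r : ℕ)
    (H : RGClass.{u}) : ∑' K, s (r + 1) K * (if K.ball r = H then 1 else 0) = s r H := by
  have h1 := hs.tendsto_tsum (r + 1) (F := fun K => if K.ball r = H then 1 else 0) (C := 1)
    fun K => by split_ifs <;> simp
  refine tendsto_nhds_unique h1 ((hs.1 r H).congr fun n => ?_)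
  have := Fintype.ofFinite (V n)
  have h2 := (hasSum_ballFreq_mul (T n) (r + 1) fun K => if K.ball r = H then 1 else 0).tsum_eq
  have h3 := (hasSum_ballFreq_mul (T n) r fun K => if K = H then 1 else 0).tsum_eq
  simp_rw [RGClass.ball_ball r.le_succ] at h2
  rw [h2, ← h3]
  simp

theorem BSConvergesTo.isFiniteTreeBall (hs : BSConvergesTo T s) (hT : ∀ n, (T n).IsTree) {r : ℕ}
    {H : RGClass.{u}} (h : s r H ≠ 0) : IsFiniteTreeBall r H := by
  by_contra hH
  refine h (tendsto_nhds_unique (hs.1 r H) (tendsto_const_nhds.congr fun n => ?_))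
  have : {v : V n | (rootedAt (T n) v).ball r = H} = ∅ :=
    Set.eq_empty_of_forall_notMem fun v hv => hH ⟨V n, T n, v, inferInstance, hT n, hv.symm⟩
  simp [ballFreq, this]

end Limit

/-! ### Projective limits of discrete laws -/

section ProjectiveLimit

open ProbabilityTheory

/-- The kernel of conditional distributions given the value of a discrete function `f` under `q`
(and `q` itself where this is not defined). -/
noncomputable def condKernelOfFun {α β : Type*} [MeasurableSpace α] [MeasurableSpace β]
    [DiscreteMeasurableSpace α] (f : β → α) (q : Measure β) : Kernel α β := by
  classical
  exact ⟨fun a => if q (f ⁻¹' {a}) = 0 then q else q[|f ⁻¹' {a}], .of_discrete⟩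

variable {α β : Type*} [MeasurableSpace α] [MeasurableSpace β] [DiscreteMeasurableSpace α]

instance isMarkovKernel_condKernelOfFun (f : β → α) (q : Measure β) [IsProbabilityMeasure q] :
    IsMarkovKernel (condKernelOfFun f q) := by
  refine ⟨fun a => ?_⟩
  change IsProbabilityMeasure (if q (f ⁻¹' {a}) = 0 then q else q[|f ⁻¹' {a}])
  split_ifs with h
  · infer_instance
  · exact cond_isProbabilityMeasure h

theorem condKernelOfFun_apply_mul {f : β → α} (hf : Measurable f) (q : Measure β)
    [IsProbabilityMeasure q] (a : α) (t : Set β) :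
    condKernelOfFun f q a t * q (f ⁻¹' {a}) = q (f ⁻¹' {a} ∩ t) := by
  change (if q (f ⁻¹' {a}) = 0 then q else q[|f ⁻¹' {a}]) t * _ = _
  split_ifs with h
  · rw [h, mul_zero, measure_inter_null_of_null_left _ h]
  · exact cond_mul_eq_inter (hf (measurableSet_singleton a)) t q

/-- A projective sequence of probability measures on countable discrete spaces has a limit. -/
theorem exists_projectiveLimit_of_countable {X : ℕ → Type u} [∀ n, MeasurableSpace (X n)]
    [∀ n, Countable (X n)] [∀ n, DiscreteMeasurableSpace (X n)] (f : ∀ n, X (n + 1) → X n)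
    (p : ∀ n, Measure (X n)) [∀ n, IsProbabilityMeasure (p n)]
    (hp : ∀ n, (p (n + 1)).map (f n) = p n) :
    ∃ P : Measure (∀ n, X n), IsProbabilityMeasure P ∧ (∀ n, P.map (fun x => x n) = p n) ∧
      ∀ᵐ x ∂P, ∀ n, f n (x (n + 1)) = x n := by
  have hf : ∀ n, Measurable (f n) := fun n => .of_discrete
  -- Given the history, the next state is drawn from `p (n + 1)` conditioned on projecting to the
  -- current state; the Ionescu-Tulcea construction then gives P.
  let κ : ∀ n, Kernel ((i : Finset.Iic n) → X i) (X (n + 1)) := fun n =>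
    (condKernelOfFun (f n) (p (n + 1))).comap (fun x => x ⟨n, Finset.mem_Iic.2 le_rfl⟩)
      (by fun_prop)
  have hκ : ∀ n, IsMarkovKernel (κ n) := fun n => by
    dsimp only [κ]
    infer_instance
  let P := Kernel.trajMeasure (p 0) κ
  have hP : IsProbabilityMeasure P := inferInstance
  have hzero : P.map (fun x => x 0) = p 0 := by
    have h1 : P.map (Preorder.frestrictLe 0) = (p 0).map (MeasurableEquiv.piUnique
        (fun i : Finset.Iic 0 => X i)).symm := by
      dsimp only [P, Kernel.trajMeasure]
      rw [Measure.map_comp _ _ (by fun_prop), Kernel.traj_map_frestrictLe,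
        Kernel.partialTraj_self, Measure.id_comp]
      rfl
    have h2 : (fun x : ∀ n, X n => x 0) = (fun y : (i : Finset.Iic 0) → X i =>
        y ⟨0, Finset.mem_Iic.2 le_rfl⟩) ∘ Preorder.frestrictLe 0 := rfl
    rw [h2, ← Measure.map_map (by fun_prop) (by fun_prop), h1]
    have h3 : Measurable fun y : (i : Finset.Iic 0) → X i => y ⟨0, Finset.mem_Iic.2 le_rfl⟩ :=
      measurable_pi_apply _
    exact (Measure.map_map h3 (MeasurableEquiv.piUnique
      (fun i : Finset.Iic 0 => X i)).symm.measurable).trans Measure.map_id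
  have hjoint : ∀ n, P.map (fun x => x n) = p n →
      P.map (fun x => (x n, x (n + 1))) = (p (n + 1)).map (fun b => (f n b, b)) := by
    intro n hn
    refine Measure.ext_of_singleton fun ⟨a, b⟩ => ?_
    have h1 := congrArg (fun μ => μ (((fun y : (i : Finset.Iic n) → X i =>
        y ⟨n, Finset.mem_Iic.2 le_rfl⟩) ⁻¹' {a}) ×ˢ {b}))
      (Kernel.map_frestrictLe_trajMeasure_compProd_eq_map_trajMeasure (μ₀ := p 0) (κ := κ) (a := n))
    have hma : MeasurableSet ((fun y : (i : Finset.Iic n) → X i =>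
        y ⟨n, Finset.mem_Iic.2 le_rfl⟩) ⁻¹' {a}) :=
      measurableSet_preimage (by fun_prop) (measurableSet_singleton a)
    dsimp only at h1
    rw [Measure.compProd_apply_prod hma (measurableSet_singleton b),
      Measure.map_apply (by fun_prop) (hma.prod (measurableSet_singleton b)),
      setLIntegral_congr_fun (g := fun _ => condKernelOfFun (f n) (p (n + 1)) a {b}) hma
        (fun y hy => by
          have hy' : y ⟨n, Finset.mem_Iic.2 le_rfl⟩ = a := hy
          change condKernelOfFun (f n) (p (n + 1)) (y ⟨n, Finset.mem_Iic.2 le_rfl⟩) {b} = _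
          rw [hy']),
      setLIntegral_const, Measure.map_apply (by fun_prop) hma] at h1
    have h2 : P ((fun x : ∀ n, X n => x n) ⁻¹' {a}) = p (n + 1) (f n ⁻¹' {a}) := by
      rw [← Measure.map_apply (by fun_prop) (measurableSet_singleton a), hn, ← hp n,
        Measure.map_apply (hf n) (measurableSet_singleton a)]
    have h3 := condKernelOfFun_apply_mul (hf n) (p (n + 1)) a {b}
    rw [Measure.map_apply (by fun_prop) (measurableSet_singleton _),
      Measure.map_apply .of_discrete (measurableSet_singleton _)]
    calc P ((fun x : ∀ n, X n => (x n, x (n + 1))) ⁻¹' {(a, b)})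
        = condKernelOfFun (f n) (p (n + 1)) a {b} * P ((fun x : ∀ n, X n => x n) ⁻¹' {a}) := by
          refine Eq.trans ?_ h1.symm
          congr 1
          ext x
          simp [Prod.ext_iff]
      _ = p (n + 1) (f n ⁻¹' {a} ∩ {b}) := by rw [h2, h3]
      _ = _ := by
          congr 1
          ext x
          simp [Prod.ext_iff]
  have hmarg : ∀ n, P.map (fun x => x n) = p n := by
    intro n
    induction n with
    | zero => exact hzero
    | succ n ih =>
      have h1 := congrArg (Measure.map Prod.snd) (hjoint n ih)
      rw [Measure.map_map measurable_snd (by fun_prop),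
        Measure.map_map measurable_snd .of_discrete] at h1
      exact h1.trans Measure.map_id
  refine ⟨P, hP, hmarg, ae_all_iff.2 fun n => ?_⟩
  have h1 : ∀ᵐ y ∂P.map (fun x => (x n, x (n + 1))), f n y.2 = y.1 := by
    rw [hjoint n (hmarg n), ae_map_iff Measurable.of_discrete.aemeasurable (by measurability)]
    exact .of_forall fun b => rfl
  exact ae_of_ae_map (by fun_prop) h1

end ProjectiveLimit

/-! ### Existence and uniqueness of the random rooted tree -/

/-- The probability mass function with given real weights. -/
noncomputable def pmfOfHasSum {α : Type*} (s : α → ℝ) (h0 : ∀ a, 0 ≤ s a) (h1 : HasSum s 1) :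
    PMF α :=
  ⟨fun a => ENNReal.ofReal (s a), by
    have h := ENNReal.ofReal_tsum_of_nonneg h0 h1.summable
    rw [h1.tsum_eq, ENNReal.ofReal_one] at h
    exact h ▸ ENNReal.summable.hasSum⟩

/-- The type may be uncountable, so singletons alone do not determine a measure. Here the atoms
already carry mass 1: the sum of atoms lies below μ, and both are probability measures. -/
theorem eq_toMeasure_pmfOfHasSum {α : Type*} [MeasurableSpace α] [DiscreteMeasurableSpace α]
    {μ : Measure α} [IsProbabilityMeasure μ] {s : α → ℝ} (h0 : ∀ a, 0 ≤ s a) (h1 : HasSum s 1)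
    (hμ : ∀ a, μ.real {a} = s a) : μ = (pmfOfHasSum s h0 h1).toMeasure := by
  have hle : (pmfOfHasSum s h0 h1).toMeasure ≤ μ := by
    refine Measure.le_iff.2 fun A hA => ?_
    classical
    rw [PMF.toMeasure_apply _ hA, ENNReal.tsum_eq_iSup_sum]
    refine iSup_le fun F => ?_
    calc ∑ x ∈ F, A.indicator (pmfOfHasSum s h0 h1) x
        = ∑ x ∈ F.filter (· ∈ A), μ {x} := by
          rw [Finset.sum_filter]
          refine Finset.sum_congr rfl fun x _ => ?_
          rw [Set.indicator_apply]
          congr 1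
          change ENNReal.ofReal (s x) = _
          rw [← hμ x, ofReal_measureReal]
      _ = μ (F.filter (· ∈ A)) := sum_measure_singleton
      _ ≤ μ A := measure_mono fun x hx => by
          simp only [Finset.coe_filter] at hx
          exact hx.2
  exact (Measure.eq_of_le_of_isProbabilityMeasure hle).symm

instance : MeasurableSpace RGClass.{u} := ⊤

instance : DiscreteMeasurableSpace RGClass.{u} := ⟨fun _ => trivial⟩

theorem measurable_lfRootedTree_ball (r : ℕ) :
    Measurable fun x : LFRootedTree.{u} => x.1.ball r :=
  Measurable.of_comap_le (le_iSup (fun r : ℕ =>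
    MeasurableSpace.comap (fun x : LFRootedTree.{u} => x.1.ball r) ⊤) r)

theorem measurable_lfRootedTree_of_ball {α : Type*} [MeasurableSpace α] {f : α → LFRootedTree.{u}}
    (h : ∀ r, Measurable fun a => (f a).1.ball r) : Measurable f := by
  refine Measurable.of_le_map (iSup_le fun r => ?_)
  rintro _ ⟨A, -, rfl⟩
  exact h r (MeasurableSet.of_discrete (s := A))

theorem HasBallStatistics.map_ball {σ : ProbabilityMeasure LFRootedTree.{u}}
    {s : ℕ → RGClass.{u} → ℝ} (h : HasBallStatistics σ s) (r : ℕ) (h0 : ∀ H, 0 ≤ s r H)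
    (h1 : HasSum (s r) 1) :
    (σ : Measure LFRootedTree.{u}).map (fun x => x.1.ball r) =
      (pmfOfHasSum (s r) h0 h1).toMeasure := by
  have := Measure.isProbabilityMeasure_map (μ := (σ : Measure LFRootedTree.{u}))
    (measurable_lfRootedTree_ball r).aemeasurable
  refine eq_toMeasure_pmfOfHasSum h0 h1 fun H => ?_
  rw [map_measureReal_apply (measurable_lfRootedTree_ball r) (measurableSet_singleton H)]
  exact h r H

/-- A law of random rooted trees is determined by its ball statistics. -/
theorem HasBallStatistics.unique {σ τ : ProbabilityMeasure LFRootedTree.{u}}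
    {s : ℕ → RGClass.{u} → ℝ} (hσ : HasBallStatistics σ s) (hτ : HasBallStatistics τ s)
    (h0 : ∀ r H, 0 ≤ s r H) (h1 : ∀ r, HasSum (s r) 1) : σ = τ := by
  refine Subtype.ext ?_
  change (σ : Measure LFRootedTree.{u}) = (τ : Measure LFRootedTree.{u})
  refine ext_of_generate_finite _
    (MeasurableSpace.generateFrom_iUnion_measurableSet fun r : ℕ =>
      MeasurableSpace.comap (fun x : LFRootedTree.{u} => x.1.ball r) ⊤).symm
    (isPiSystem_iUnion_of_monotone _ (fun r =>
      @MeasurableSpace.isPiSystem_measurableSet _ (MeasurableSpace.comap _ ⊤)) ?_) ?_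
    (by simp)
  -- The ball σ-algebras increase with r, as smaller balls are read off from larger ones; hence
  -- their union is a π-system.
  · rintro r r' h _ ⟨A, -, rfl⟩
    refine ⟨RGClass.ball r ⁻¹' A, trivial, ?_⟩
    ext x
    simp [RGClass.ball_ball h]
  · intro S hS
    obtain ⟨r, A, -, rfl⟩ := Set.mem_iUnion.1 hS
    have h := (hσ.map_ball r (h0 r) (h1 r)).trans (hτ.map_ball r (h0 r) (h1 r)).symm
    have h2 : (σ : Measure LFRootedTree.{u}).map (fun x => x.1.ball r) A =
        (τ : Measure LFRootedTree.{u}).map (fun x => x.1.ball r) A := by rw [h]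
    rwa [Measure.map_apply (measurable_lfRootedTree_ball r) .of_discrete,
      Measure.map_apply (measurable_lfRootedTree_ball r) .of_discrete] at h2

theorem HasBallStatistics.integral_ball {σ : ProbabilityMeasure LFRootedTree.{u}}
    {s : ℕ → RGClass.{u} → ℝ} (h : HasBallStatistics σ s) (r : ℕ) (h0 : ∀ H, 0 ≤ s r H)
    (h1 : HasSum (s r) 1) {F : RGClass.{u} → ℝ} {C : ℝ} (hF : ∀ H, |F H| ≤ C) :
    ∫ x, F (x.1.ball r) ∂(σ : Measure LFRootedTree.{u}) = ∑' H, s r H * F H := by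
  have hFs : StronglyMeasurable F := Measurable.of_discrete.stronglyMeasurable
  rw [← integral_map (measurable_lfRootedTree_ball r).aemeasurable hFs.aestronglyMeasurable,
    h.map_ball r h0 h1, PMF.integral_eq_tsum]
  · refine tsum_congr fun H => ?_
    rw [smul_eq_mul]
    congr 1
    exact ENNReal.toReal_ofReal (h0 H)
  · exact .of_bound hFs.aestronglyMeasurable C (.of_forall hF)

theorem ae_pmfOfHasSum_ne_zero {α : Type*} [MeasurableSpace α] [DiscreteMeasurableSpace α]
    {s : α → ℝ} (h0 : ∀ a, 0 ≤ s a) (h1 : HasSum s 1) :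
    ∀ᵐ a ∂(pmfOfHasSum s h0 h1).toMeasure, s a ≠ 0 := by
  rw [ae_iff, PMF.toMeasure_apply_eq_zero_iff _ .of_discrete, Set.disjoint_left]
  intro a ha ha'
  simp only [not_not, Set.mem_ofPred_eq] at ha'
  refine ha ?_
  change ENNReal.ofReal (s a) = 0
  rw [ha', ENNReal.ofReal_zero]

/-- Consistent statistics of balls of finite trees are the ball statistics of a random tree. -/
theorem exists_hasBallStatistics {s : ℕ → RGClass.{u} → ℝ} (h0 : ∀ r H, 0 ≤ s r H)
    (h1 : ∀ r, HasSum (s r) 1) (hgood : ∀ r H, s r H ≠ 0 → IsFiniteTreeBall r H)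
    (hcons : ∀ r, ((pmfOfHasSum (s (r + 1)) (h0 _) (h1 _)).toMeasure).map (RGClass.ball r) =
      (pmfOfHasSum (s r) (h0 _) (h1 _)).toMeasure) :
    ∃ σ : ProbabilityMeasure LFRootedTree.{u}, HasBallStatistics σ s := by
  classical
  let ν : ℕ → Measure RGClass.{u} := fun r => (pmfOfHasSum (s r) (h0 r) (h1 r)).toMeasure
  have hν : ∀ r, IsProbabilityMeasure (ν r) := fun r => PMF.toMeasure.isProbabilityMeasure _
  have hνs : ∀ r H, ν r {H} = ENNReal.ofReal (s r H) := fun r H =>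
    PMF.toMeasure_apply_singleton _ _ (measurableSet_singleton H)
  have hνc : ∀ r, (ν (r + 1)).map (RGClass.ball r) = ν r := hcons
  -- Passing to the supports makes the state spaces countable, as the projective limit requires.
  let X : ℕ → Type (u + 1) := fun r => {H : RGClass.{u} // s r H ≠ 0}
  have hX : ∀ r, Nonempty (X r) := fun r => by
    by_contra h
    have h2 : s r = 0 := funext fun H => by
      by_contra hH
      exact h ⟨⟨H, hH⟩⟩
    have h3 := h1 r
    rw [h2] at h3
    exact zero_ne_one (hasSum_zero.unique h3)
  have hXc : ∀ r, Countable (X r) := fun r => (h1 r).summable.countable_support.to_subtype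
  let _ : ∀ r, MeasurableSpace (X r) := fun r => ⊤
  have hXd : ∀ r, DiscreteMeasurableSpace (X r) := fun r => ⟨fun _ => trivial⟩
  let g : ∀ r, RGClass.{u} → X r := fun r H =>
    if h : s r H ≠ 0 then ⟨H, h⟩ else Classical.arbitrary _
  have hg : ∀ r H, s r H ≠ 0 → (g r H).1 = H := fun r H h => by
    dsimp only [g]
    rw [dif_pos h]
  have hgm : ∀ r, Measurable (g r) := fun r => .of_discrete
  have hgae : ∀ r, ∀ᵐ H ∂ν r, (g r H).1 = H := fun r =>
    (ae_pmfOfHasSum_ne_zero (h0 r) (h1 r)).mono (hg r)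
  let p : ∀ r, Measure (X r) := fun r => (ν r).map (g r)
  have hp : ∀ r, IsProbabilityMeasure (p r) := fun r =>
    Measure.isProbabilityMeasure_map (hgm r).aemeasurable
  let f : ∀ r, X (r + 1) → X r := fun r x => g r (x.1.ball r)
  have hf : ∀ r (x : X (r + 1)), (f r x).1 = x.1.ball r := by
    intro r x
    refine hg r _ fun h => x.2 ?_
    have h2 : ν r {x.1.ball r} = 0 := by rw [hνs, h, ENNReal.ofReal_zero]
    rw [← hνc r, Measure.map_apply .of_discrete .of_discrete] at h2
    have h3 : ν (r + 1) {x.1} = 0 := measure_mono_null (by simp) h2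
    rw [hνs, ENNReal.ofReal_eq_zero] at h3
    exact le_antisymm h3 (h0 _ _)
  have hpf : ∀ r, (p (r + 1)).map (f r) = p r := by
    intro r
    dsimp only [p]
    rw [← hνc r, Measure.map_map .of_discrete (hgm _), Measure.map_map (hgm r) .of_discrete]
    refine Measure.map_congr ((hgae (r + 1)).mono fun H hH => ?_)
    simp only [Function.comp_apply, f]
    rw [hH]
  obtain ⟨P, hP, hmarg, hcoh⟩ := exists_projectiveLimit_of_countable f p hpf
  have hlim : ∀ x : ∀ r, X r, (∀ n, f n (x (n + 1)) = x n) →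
      ∃ t : LFRootedTree.{u}, ∀ n, t.1.ball n = (x n).1 := by
    intro x hx
    refine exists_lfRootedTree (fun n => hgood n _ (x n).2) fun n => ?_
    rw [← hf n, hx n]
  obtain ⟨x₀, hx₀⟩ := hcoh.exists
  -- Incoherent sequences form a null set and are sent to one fixed tree, which keeps Φ measurable.
  let Φ : (∀ r, X r) → LFRootedTree.{u} := fun x =>
    if h : ∀ n, f n (x (n + 1)) = x n then (hlim x h).choose else (hlim x₀ hx₀).choose
  have hΦ : ∀ x, (∀ n, f n (x (n + 1)) = x n) → ∀ n, (Φ x).1.ball n = (x n).1 := by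
    intro x hx n
    dsimp only [Φ]
    rw [dif_pos hx]
    exact (hlim x hx).choose_spec n
  have hC : MeasurableSet {x : ∀ r, X r | ∀ n, f n (x (n + 1)) = x n} := by
    rw [Set.ofPred_forall]
    refine MeasurableSet.iInter fun n => ?_
    have h2 : Measurable fun x : ∀ r, X r => (x n, x (n + 1)) := by fun_prop
    exact h2 (MeasurableSet.of_discrete (s := {y : X n × X (n + 1) | f n y.2 = y.1}))
  have hΦm : Measurable Φ := by
    refine measurable_lfRootedTree_of_ball fun r => ?_
    have h2 : (fun x => (Φ x).1.ball r) = fun x => if ∀ n, f n (x (n + 1)) = x n then (x r).1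
        else ((hlim x₀ hx₀).choose).1.ball r := by
      funext x
      split_ifs with hx
      · exact hΦ x hx r
      · dsimp only [Φ]
        rw [dif_neg hx]
    rw [h2]
    have h3 : Measurable fun y : X r => y.1 := .of_discrete
    exact Measurable.ite hC (h3.comp (measurable_pi_apply r)) measurable_const
  refine ⟨⟨P.map Φ, Measure.isProbabilityMeasure_map hΦm.aemeasurable⟩, fun r H => ?_⟩
  change (P.map Φ).real ((fun x : LFRootedTree.{u} => x.1.ball r) ⁻¹' {H}) = s r H
  have h2 : (P.map Φ) ((fun x : LFRootedTree.{u} => x.1.ball r) ⁻¹' {H}) = ν r {H} := by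
    rw [Measure.map_apply hΦm (measurable_lfRootedTree_ball r (measurableSet_singleton H))]
    have h3 : Φ ⁻¹' ((fun x : LFRootedTree.{u} => x.1.ball r) ⁻¹' {H}) =ᵐ[P]
        (fun x => x r) ⁻¹' ((fun y : X r => y.1) ⁻¹' {H}) := by
      refine hcoh.mono fun x hx => propext ?_
      change (Φ x).1.ball r = H ↔ (x r).1 = H
      rw [hΦ x hx]
    rw [measure_congr h3, ← Measure.map_apply (measurable_pi_apply r) .of_discrete, hmarg r]
    dsimp only [p]
    rw [Measure.map_apply (hgm r) .of_discrete]
    refine measure_congr ((hgae r).mono fun K hK => propext ?_)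
    change (g r K).1 = H ↔ K = H
    rw [hK]
  rw [measureReal_def, h2, hνs, ENNReal.toReal_ofReal (h0 r H)]

theorem BSConvergesTo.map_ball_eq {V : ℕ → Type u} [∀ n, Finite (V n)] [∀ n, Nonempty (V n)]
    {T : ∀ n, SimpleGraph (V n)} {s : ℕ → RGClass.{u} → ℝ} (hs : BSConvergesTo T s) (r : ℕ) :
    ((pmfOfHasSum (s (r + 1)) (hs.nonneg _) (hs.2 _)).toMeasure).map (RGClass.ball r) =
      (pmfOfHasSum (s r) (hs.nonneg _) (hs.2 _)).toMeasure := by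
  classical
  have hm : Measurable (RGClass.ball.{u} r) := .of_discrete
  have := Measure.isProbabilityMeasure_map
    (μ := (pmfOfHasSum (s (r + 1)) (hs.nonneg _) (hs.2 _)).toMeasure) hm.aemeasurable
  refine eq_toMeasure_pmfOfHasSum _ _ fun H => ?_
  rw [map_measureReal_apply hm .of_discrete, ← hs.tsum_ball_eq r H,
    ← integral_indicator_one .of_discrete, PMF.integral_eq_tsum]
  · refine tsum_congr fun K => ?_
    rw [smul_eq_mul]
    congr 1
    exact ENNReal.toReal_ofReal (hs.nonneg _ K)
  · refine .of_bound Measurable.of_discrete.aestronglyMeasurable 1 (.of_forall fun K => ?_)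
    rw [Set.indicator_apply]
    split_ifs <;> simp

/-! ### Passing to the limit -/

/-- The local approximation of `log (1 + 1 / M)` that depends on the `r`-ball only. -/
noncomputable def truncEntropy (r : ℕ) (H : RGClass.{u}) : ℝ :=
  logOneAddInv (min H.minSubtrees (r + 1))

theorem abs_truncEntropy_le (r : ℕ) (H : RGClass.{u}) : |truncEntropy r H| ≤ 1 := by
  rw [truncEntropy, abs_of_nonneg (logOneAddInv_nonneg _)]
  exact logOneAddInv_le_one _

theorem abs_truncEntropy_sub_le {V : Type u} {T : SimpleGraph V} (hT : T.IsAcyclic) (v : V) {r : ℕ}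
    (hr : 1 ≤ r) : |truncEntropy r ((rootedAt T v).ball r) - logOneAddInv (minSubtreesAt T v)| ≤
      ((r : ℝ) + 1)⁻¹ := by
  rw [truncEntropy, min_minSubtrees_ball hT v hr]
  exact abs_logOneAddInv_min_sub_le _ r

theorem abs_truncEntropy_sub_entropyFun_le (x : LFRootedTree.{u}) {r : ℕ} (hr : 1 ≤ r) :
    |truncEntropy r (x.1.ball r) - entropyFun x| ≤ ((r : ℝ) + 1)⁻¹ := by
  obtain ⟨x, V, T, v, hT, -, rfl⟩ := x
  exact abs_truncEntropy_sub_le hT.isAcyclic v hr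

theorem measurable_truncEntropy_ball (r : ℕ) :
    Measurable fun x : LFRootedTree.{u} => truncEntropy r (x.1.ball r) :=
  (Measurable.of_discrete (f := truncEntropy r)).comp (measurable_lfRootedTree_ball r)

/-- No single ball need determine f, but f is the limit of measurable ball functions. The shift to r
+ 1 avoids radius 0, where the approximation is not available. -/
theorem measurable_entropyFun : Measurable entropyFun.{u} := by
  refine measurable_of_tendsto_metrizable (fun r => measurable_truncEntropy_ball.{u} (r + 1)) ?_
  rw [tendsto_pi_nhds]
  intro x
  rw [tendsto_iff_norm_sub_tendsto_zero]
  refine squeeze_zero (fun r => norm_nonneg _)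
    (fun r => abs_truncEntropy_sub_entropyFun_le x (Nat.le_add_left 1 r)) ?_
  have := tendsto_one_div_add_atTop_nhds_zero_nat (𝕜 := ℝ)
  simpa [Function.comp_def] using this.comp (tendsto_add_atTop_nat 1)

theorem integrable_entropyFun (σ : Measure LFRootedTree.{u}) [IsFiniteMeasure σ] :
    Integrable entropyFun σ := by
  refine .of_bound measurable_entropyFun.aestronglyMeasurable 1 (.of_forall fun x => ?_)
  exact (abs_of_nonneg (logOneAddInv_nonneg x.1.minSubtrees)).trans_le (logOneAddInv_le_one _)

/-- The averages of `log (1 + 1 / M(T, v))` over the vertices converge to the expectation in the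
limit tree. -/
theorem tendsto_average_entropy {V : ℕ → Type u} [∀ n, Fintype (V n)] {T : ∀ n, SimpleGraph (V n)}
    (hT : ∀ n, (T n).IsTree) {s : ℕ → RGClass.{u} → ℝ} (hs : BSConvergesTo T s)
    {σ : ProbabilityMeasure LFRootedTree.{u}} (hσ : HasBallStatistics σ s) :
    Tendsto (fun n => (∑ v, logOneAddInv (minSubtreesAt (T n) v)) / (Nat.card (V n) : ℝ)) atTop
      (𝓝 (∫ x, entropyFun x ∂(σ : Measure LFRootedTree.{u}))) := by
  have hne : ∀ n, Nonempty (V n) := fun n => (hT n).connected.nonempty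
  rw [Metric.tendsto_atTop]
  intro ε hε
  obtain ⟨k, hk⟩ := exists_nat_one_div_lt (show 0 < ε / 3 by positivity)
  obtain ⟨r, hr, hrε⟩ : ∃ r : ℕ, 1 ≤ r ∧ ((r : ℝ) + 1)⁻¹ < ε / 3 := by
    refine ⟨k + 1, Nat.le_add_left 1 k, lt_of_le_of_lt ?_ hk⟩
    rw [one_div]
    refine inv_anti₀ (by positivity) ?_
    push_cast
    linarith
  -- With r fixed, only the ball function is passed to the limit. Replacing f by it costs less than
  -- ε/3 both in the finite average and in the expectation.
  have h1 := hs.tendsto_tsum r (abs_truncEntropy_le r)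
  rw [← hσ.integral_ball r (hs.nonneg r) (hs.2 r) (abs_truncEntropy_le r)] at h1
  simp_rw [fun n => (hasSum_ballFreq_mul (T n) r (truncEntropy r)).tsum_eq] at h1
  obtain ⟨N, hN⟩ := Metric.tendsto_atTop.1 h1 (ε / 3) (by positivity)
  refine ⟨N, fun n hn => ?_⟩
  have h2 : |∫ x : LFRootedTree.{u}, truncEntropy r (x.1.ball r) ∂(σ : Measure LFRootedTree.{u}) -
      ∫ x, entropyFun x ∂(σ : Measure LFRootedTree.{u})| ≤ ((r : ℝ) + 1)⁻¹ := by
    rw [← integral_sub _ (integrable_entropyFun _)]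
    · have := norm_integral_le_of_norm_le_const (μ := (σ : Measure LFRootedTree.{u}))
        (f := fun x => truncEntropy r (x.1.ball r) - entropyFun x) (C := ((r : ℝ) + 1)⁻¹)
        (.of_forall fun x => abs_truncEntropy_sub_entropyFun_le x hr)
      simpa using this
    · exact .of_bound (measurable_truncEntropy_ball r).aestronglyMeasurable 1
        (.of_forall fun x => abs_truncEntropy_le r _)
  have h3 : |(∑ v, truncEntropy r ((rootedAt (T n) v).ball r)) / (Nat.card (V n) : ℝ) -
      (∑ v, logOneAddInv (minSubtreesAt (T n) v)) / (Nat.card (V n) : ℝ)| ≤ ((r : ℝ) + 1)⁻¹ := by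
    have hpos : (0 : ℝ) < Nat.card (V n) := by exact_mod_cast Nat.card_pos
    rw [← sub_div, ← Finset.sum_sub_distrib, abs_div, abs_of_pos hpos, div_le_iff₀ hpos]
    calc _ ≤ ∑ v : V n, |truncEntropy r ((rootedAt (T n) v).ball r) -
          logOneAddInv (minSubtreesAt (T n) v)| := Finset.abs_sum_le_sum_abs _ _
      _ ≤ ∑ _v : V n, ((r : ℝ) + 1)⁻¹ :=
          Finset.sum_le_sum fun v _ => abs_truncEntropy_sub_le (hT n).isAcyclic v hr
      _ = _ := by simp [Nat.card_eq_fintype_card, mul_comm]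
  have h4 := hN n hn
  rw [Real.dist_eq] at h4 ⊢
  rw [abs_le] at h2 h3
  rw [abs_lt] at h4 ⊢
  constructor <;> linarith [h2.1, h2.2, h3.1, h3.2, h4.1, h4.2]

theorem tendsto_log_add_one_div :
    Tendsto (fun m : ℕ => (Real.log m + 1) / (m : ℝ)) atTop (𝓝 0) := by
  have h1 := Real.isLittleO_log_id_atTop.tendsto_div_nhds_zero.comp tendsto_natCast_atTop_atTop
  have h2 := h1.add (tendsto_one_div_atTop_nhds_zero_nat (𝕜 := ℝ))
  simpa [add_div, Function.comp_def] using h2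

theorem theorem1 {V : ℕ → Type u} [∀ n, Finite (V n)] (T : ∀ n, SimpleGraph (V n))
    (hT : ∀ n, (T n).IsTree) (hcard : Tendsto (fun n => Nat.card (V n)) atTop atTop)
    (s : ℕ → RGClass.{u} → ℝ) (hs : BSConvergesTo T s) :
    (∃! σ : ProbabilityMeasure LFRootedTree.{u}, HasBallStatistics σ s) ∧
    ∀ σ : ProbabilityMeasure LFRootedTree.{u}, HasBallStatistics σ s →
      Integrable entropyFun (σ : Measure LFRootedTree.{u}) ∧
      Tendsto (fun n => Real.log (numSubtrees (T n)) / (Nat.card (V n) : ℝ)) atTop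
        (𝓝 (∫ x, entropyFun x ∂(σ : Measure LFRootedTree.{u}))) := by
  have hne : ∀ n, Nonempty (V n) := fun n => (hT n).connected.nonempty
  have hfin : ∀ n, Fintype (V n) := fun n => Fintype.ofFinite (V n)
  refine ⟨?_, fun σ hσ => ⟨integrable_entropyFun _, ?_⟩⟩
  · obtain ⟨σ, hσ⟩ := exists_hasBallStatistics hs.nonneg hs.2
      (fun r H h => hs.isFiniteTreeBall hT h) hs.map_ball_eq
    exact ⟨σ, hσ, fun τ hτ => hτ.unique hσ hs.nonneg hs.2⟩
  · have h1 := tendsto_average_entropy hT hs hσ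
    have h2 : Tendsto (fun n => Real.log (numSubtrees (T n)) / (Nat.card (V n) : ℝ) -
        (∑ v, logOneAddInv (minSubtreesAt (T n) v)) / (Nat.card (V n) : ℝ)) atTop (𝓝 0) := by
      refine squeeze_zero_norm (fun n => ?_) (tendsto_log_add_one_div.comp hcard)
      rw [← sub_div, norm_div, Real.norm_natCast, Real.norm_eq_abs, Function.comp_apply]
      exact div_le_div_of_nonneg_right (abs_log_numSubtrees_sub_sum_le (hT n)) (Nat.cast_nonneg _)
    simpa using h2.add h1
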